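/- A model strip is a set $S\subset\mathbb R\times[-1,1]$ that contains $\mathbb R\times(-1,1)$ and for which $S\cap(\mathbb R\times\{-1,1\})$ is a (possibly empty) union of open finite intervals with mutually disjoint closures; these are its boundary intervals, $\partial_\pm S=S\cap(\mathbb R\times\{\pm1\})$ are its two sides, and $\partial S=\partial_-S\cup\partial_+S$. A stripped surface is a quotient space $Z=\bigsqcup_{\alpha\in A}S_\alpha/\{Y_\beta\overset{\phi_\beta}{\sim}X_\beta\}_{\beta\in B}$, where the $S_\alpha$ are model strips, the $X_\beta,Y_\beta$ ($\beta\in B$) are pairwise distinct boundary intervals of these strips, and each $\phi_\beta:Y_\beta\to X_\beta$ is an affine homeomorphism, preserving or reversing orientation. Let $\xi_\alpha:S_\alpha\to Z$ be the canonical maps and $\widehat S_\alpha=\xi_\alpha(S_\alpha)$ the strips of $Z$. The leaves of the canonical foliation $\mathcal F_Z$ are the images under the $\xi_\alpha$ of the lines $\mathbb R\times\{y\}$, $-1<y<1$, and of the boundary intervals. A boundary leaf is the image of a boundary interval that is not glued to another one; a special leaf is the common image of a glued pair $X_\beta,Y_\beta$ such that at least one of the two intervals is not a whole side of its strip. $Z$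 is reduced if the image of each glued pair is a special leaf. Let $\mathcal H(\mathcal F_Z)$ be the group of homeomorphisms of $Z$ that map leaves onto leaves, with the compact-open topology, let $\mathcal H_0(\mathcal F_Z)$ be its identity path component, and let $\mathcal H_0(\mathcal F_Z)'$ be the subgroup of those $h$ such that $h(\omega)=\omega$, with orientation preserved, for each leaf $\omega$. **Theorem.** Let $Z$ be a connected reduced stripped surface. (0) If $h\in\mathcal H(\mathcal F_Z)$ satisfies $h(\widehat S_\alpha)=\widehat S_\alpha$ for all $\alpha\in A$, then for each $\alpha$ there is a unique homeomorphism $g_\alpha:S_\alpha\to S_\alpha$ with $\xi_\alpha\circ g_\alpha=h\circ\xi_\alpha$, and it has the form $g_\alpha(x,y)=(\lambda(x,y),\mu(y))$ with $\lambda:S_\alpha\to\mathbb R$ continuous and $\mu:[-1,1]\to[-1,1]$ a homeomorphism. (1) An element $h\in\mathcal H(\mathcal F_Z)$ belongs to $\mathcal H_0(\mathcal F_Z)$ if and only if the following three conditions hold: (a) $h(\widehat S_\alpha)=\widehat S_\alpha$ for all $\alpha\in A$; (b) for each $\alpha\in A$, the lift $g_\alpha(x,y)=(\lambda(x,y),\mu(y))$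 of $h$ to $S_\alpha$ has $\mu$ increasing and $\lambda(x,y)$ increasing in $x$ for each fixed $y\in(-1,1)$; (c) $h(\omega)=\omega$, with orientation preserved, for each boundary leaf and each special leaf $\omega$. (2) $\mathcal H_0(\mathcal F_Z)'$ is contained in $\mathcal H_0(\mathcal F_Z)$ and is a strong deformation retract of it: the identity map of $\mathcal H_0(\mathcal F_Z)$ is homotopic, relative to $\mathcal H_0(\mathcal F_Z)'$, to a map with values in $\mathcal H_0(\mathcal F_Z)'$. Moreover, $\mathcal H_0(\mathcal F_Z)$ is contractible. -/

import Mathlib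

open Set Topology

universe u v

/-! ### Model strips -/

/-- The two horizontal boundary levels of `ℝ × [-1, 1]`: `true` is the level `1` (upper), `false`
is the level `-1` (lower). -/
def stripLevel (s : Bool) : ℝ := if s then 1 else -1

/-- A model strip, i.e. a set `ℝ × (-1, 1) ⊆ S ⊆ ℝ × [-1, 1]` such that `S ∩ (ℝ × {-1, 1})` is a
union of open finite intervals with mutually disjoint closures.  Since the closures are disjoint,
these intervals are exactly the connected components of `S ∩ (ℝ × {-1, 1})`, hence determined by
`S`; they are recorded through the pairs `(a, b)` of their end points, separately for each level. -/
structure ModelStrip where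
  /-- end points of the boundary intervals at a given level -/
  ends : Bool → Set (ℝ × ℝ)
  lt_of_mem : ∀ s, ∀ i ∈ ends s, i.1 < i.2
  disjoint_closures : ∀ s, (ends s).Pairwise fun i j => Disjoint (Icc i.1 i.2) (Icc j.1 j.2)

namespace ModelStrip

/-- The set `S ⊆ ℝ × [-1, 1]` underlying a model strip. -/
def carrier (S : ModelStrip) : Set (ℝ × ℝ) :=
  {p | p.2 ∈ Ioo (-1 : ℝ) 1 ∨ ∃ s, p.2 = stripLevel s ∧ ∃ i ∈ S.ends s, p.1 ∈ Ioo i.1 i.2}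

/-- The points of a model strip, with the topology of a subspace of the plane. -/
abbrev Pt (S : ModelStrip) : Type := ↥S.carrier

/-- `∂₊S` (for `s = true`) and `∂₋S` (for `s = false`). -/
def bd (S : ModelStrip) (s : Bool) : Set S.Pt := {p | p.1.2 = stripLevel s}

/-- A boundary interval of a model strip. -/
structure Interval (S : ModelStrip) where
  side : Bool
  left : ℝ
  right : ℝ
  mem : (left, right) ∈ S.ends side

/-- The boundary interval as a subset of the strip. -/
def Interval.toSet {S : ModelStrip} (I : S.Interval) : Set S.Pt :=
  {p | p.1.2 = stripLevel I.side ∧ p.1.1 ∈ Ioo I.left I.right}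

/-- The point of a boundary interval with a given first coordinate. -/
def Interval.point {S : ModelStrip} (I : S.Interval) (t : Ioo I.left I.right) : S.Pt :=
  ⟨((t : ℝ), stripLevel I.side), Or.inr ⟨I.side, rfl, (I.left, I.right), I.mem, t.2⟩⟩

/-- The leaves of the canonical foliation of a model strip: the lines `ℝ × {y}` with `-1 < y < 1`,
and the boundary intervals. -/
def IsLeaf (S : ModelStrip) (L : Set S.Pt) : Prop :=
  (∃ y ∈ Ioo (-1 : ℝ) 1, L = {p : S.Pt | p.1.2 = y}) ∨ ∃ I : S.Interval, L = I.toSet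

theorem stripLevel_injective : Function.Injective stripLevel := by
  intro s t h
  cases s <;> cases t <;> simp [stripLevel] at h ⊢ <;> norm_num at h

theorem stripLevel_not_mem (s : Bool) : stripLevel s ∉ Ioo (-1 : ℝ) 1 := by
  cases s <;> simp [stripLevel]

theorem exists_isLeaf_mem (S : ModelStrip) (p : S.Pt) : ∃ L, S.IsLeaf L ∧ p ∈ L := by
  rcases p with ⟨p, hp | ⟨s, hs, i, hi, hpi⟩⟩
  · exact ⟨{q : S.Pt | q.1.2 = p.2}, Or.inl ⟨_, hp, rfl⟩, rfl⟩
  · exact ⟨_, Or.inr ⟨⟨s, i.1, i.2, hi⟩, rfl⟩, hs, hpi⟩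

theorem IsLeaf.eq_of_mem {S : ModelStrip} {L L' : Set S.Pt} (hL : S.IsLeaf L) (hL' : S.IsLeaf L')
    {p : S.Pt} (hp : p ∈ L) (hp' : p ∈ L') : L = L' := by
  rcases hL with ⟨y, hy, rfl⟩ | ⟨I, rfl⟩ <;> rcases hL' with ⟨y', hy', rfl⟩ | ⟨I', rfl⟩
  · have h1 : p.1.2 = y := hp
    have h2 : p.1.2 = y' := hp'
    rw [← h1, ← h2]
  · have h1 : p.1.2 = y := hp
    exact absurd (hp'.1 ▸ h1 ▸ hy) (stripLevel_not_mem _)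
  · have h1 : p.1.2 = y' := hp'
    exact absurd (hp.1 ▸ h1 ▸ hy') (stripLevel_not_mem _)
  · obtain ⟨s, a, b, hI⟩ := I
    obtain ⟨s', a', b', hI'⟩ := I'
    obtain rfl : s = s' := stripLevel_injective (hp.1.symm.trans hp'.1)
    by_cases h : (a, b) = (a', b')
    · obtain ⟨rfl, rfl⟩ := Prod.mk.inj h
      rfl
    · exact absurd (Ioo_subset_Icc_self hp'.2)
        (disjoint_left.1 (S.disjoint_closures s hI hI' h) (Ioo_subset_Icc_self hp.2))

end ModelStrip

/-! ### Stripped surfaces -/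

/-- The data of a stripped surface: a family of model strips `S a`, `a : A`, and a family of pairs
of boundary intervals `X b`, `Y b`, `b : B`, all of them pairwise distinct, with affine
homeomorphisms `φ b : Y b → X b` (which preserve or reverse the orientation). -/
structure StrippedSurface (A : Type u) (B : Type v) where
  S : A → ModelStrip
  X : B → Σ a, (S a).Interval
  Y : B → Σ a, (S a).Interval
  distinct : Function.Injective (Sum.elim X Y)
  φ : B → ℝ ≃ᵃ[ℝ] ℝ
  φ_image : ∀ b, φ b '' Ioo (Y b).2.left (Y b).2.right = Ioo (X b).2.left (X b).2.right

namespace StrippedSurface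

variable {A : Type u} {B : Type v} (P : StrippedSurface A B)

/-- The disjoint union of the strips. -/
abbrev Total : Type u := Σ a, (P.S a).Pt

/-- The elementary identifications: a point of `Y b` with its image under `φ b` in `X b`. -/
inductive Glue : P.Total → P.Total → Prop
  | mk (b : B) (t : Ioo (P.Y b).2.left (P.Y b).2.right) (t' : Ioo (P.X b).2.left (P.X b).2.right)
      (h : (t' : ℝ) = P.φ b t) :
      Glue ⟨(P.Y b).1, (P.Y b).2.point t⟩ ⟨(P.X b).1, (P.X b).2.point t'⟩

/-- The surface `Z`: the quotient of the disjoint union of the strips by the equivalence relation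
generated by the identifications. -/
def Z : Type u := Quot P.Glue

/-- The quotient topology. -/
instance : TopologicalSpace P.Z := inferInstanceAs (TopologicalSpace (Quot P.Glue))

/-- The chart map `ξ a : S a → Z`. -/
def ξ (a : A) (p : (P.S a).Pt) : P.Z := Quot.mk P.Glue ⟨a, p⟩

/-- The strip `Ŝ a` of `Z`. -/
def strip (a : A) : Set P.Z := range (P.ξ a)

/-- The leaf of `Z` given by a boundary interval of one of the strips. -/
def bdLeaf (I : Σ a, (P.S a).Interval) : Set P.Z := P.ξ I.1 '' I.2.toSet

/-- The leaves of the canonical foliation of `Z`. -/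
def IsLeaf (ω : Set P.Z) : Prop := ∃ a, ∃ L, (P.S a).IsLeaf L ∧ ω = P.ξ a '' L

/-- Boundary leaves: the images of the boundary intervals that are not glued. -/
def IsBoundaryLeaf (ω : Set P.Z) : Prop :=
  ∃ I : Σ a, (P.S a).Interval, I ∉ range P.X ∧ I ∉ range P.Y ∧ ω = P.bdLeaf I

/-- `I` is a whole side `∂₋S` or `∂₊S` of its strip. -/
def IsWholeSide (I : Σ a, (P.S a).Interval) : Prop :=
  I.2.toSet = (P.S I.1).bd I.2.side

/-- Special leaves: the images of the pairs of glued boundary intervals, at least one of which is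
not a whole side of its strip. -/
def IsSpecialLeaf (ω : Set P.Z) : Prop :=
  ∃ b, (¬ P.IsWholeSide (P.X b) ∨ ¬ P.IsWholeSide (P.Y b)) ∧ ω = P.bdLeaf (P.X b)

/-- A stripped surface is reduced if each leaf obtained by gluing two boundary intervals is
special. -/
def IsReduced : Prop := ∀ b, P.IsSpecialLeaf (P.bdLeaf (P.X b))

/-! ### The leaves form a partition -/

theorem exists_isLeaf_mem (z : P.Z) : ∃ ω, P.IsLeaf ω ∧ z ∈ ω := by
  induction z using Quot.ind with
  | mk p =>
    obtain ⟨a, p⟩ := p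
    obtain ⟨L, hL, hp⟩ := (P.S a).exists_isLeaf_mem p
    exact ⟨_, ⟨a, L, hL, rfl⟩, p, hp, rfl⟩

theorem bdLeaf_eq (b : B) : P.bdLeaf (P.Y b) = P.bdLeaf (P.X b) := by
  apply Subset.antisymm
  · rintro _ ⟨p, hp, rfl⟩
    have h : P.φ b p.1.1 ∈ Ioo (P.X b).2.left (P.X b).2.right :=
      P.φ_image b ▸ mem_image_of_mem _ hp.2
    refine ⟨(P.X b).2.point ⟨_, h⟩, ⟨rfl, h⟩, ?_⟩
    have h2 : (P.Y b).2.point ⟨p.1.1, hp.2⟩ = p := Subtype.ext (Prod.ext rfl hp.1.symm)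
    exact (Quot.sound (Glue.mk b ⟨p.1.1, hp.2⟩ ⟨_, h⟩ rfl)).symm.trans
      (congrArg (P.ξ (P.Y b).1) h2)
  · rintro _ ⟨p, hp, rfl⟩
    obtain ⟨t, ht, hpt⟩ := (P.φ_image b).symm ▸ hp.2
    refine ⟨(P.Y b).2.point ⟨t, ht⟩, ⟨rfl, ht⟩, ?_⟩
    have h2 : p = (P.X b).2.point ⟨p.1.1, hp.2⟩ := Subtype.ext (Prod.ext rfl hp.1)
    rw [h2]
    exact Quot.sound (Glue.mk b ⟨t, ht⟩ ⟨p.1.1, hp.2⟩ hpt.symm)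

/-- The image in `Z` of the leaf through a point of one of the strips. -/
def leafAux (p : P.Total) : Set P.Z :=
  {z | ∃ L, (P.S p.1).IsLeaf L ∧ p.2 ∈ L ∧ z ∈ P.ξ p.1 '' L}

theorem leafAux_eq {a : A} {L : Set (P.S a).Pt} (hL : (P.S a).IsLeaf L) {p : (P.S a).Pt}
    (hp : p ∈ L) : P.leafAux ⟨a, p⟩ = P.ξ a '' L := by
  ext z
  constructor
  · rintro ⟨L', hL', hp', hz⟩
    exact hL.eq_of_mem hL' hp hp' ▸ hz
  · exact fun hz => ⟨L, hL, hp, hz⟩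

theorem leafAux_glue {p q : P.Total} (h : P.Glue p q) : P.leafAux p = P.leafAux q := by
  cases h with
  | mk b t t' h =>
    rw [P.leafAux_eq (Or.inr ⟨(P.Y b).2, rfl⟩) (p := (P.Y b).2.point t) ⟨rfl, t.2⟩,
      P.leafAux_eq (Or.inr ⟨(P.X b).2, rfl⟩) (p := (P.X b).2.point t') ⟨rfl, t'.2⟩]
    exact P.bdLeaf_eq b

theorem IsLeaf.eq_of_mem {P : StrippedSurface A B} {ω ω' : Set P.Z} (h : P.IsLeaf ω)
    (h' : P.IsLeaf ω') {z : P.Z} (hz : z ∈ ω) (hz' : z ∈ ω') : ω = ω' := by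
  have key : ∀ η, P.IsLeaf η → z ∈ η →
      η = Quot.lift P.leafAux (fun _ _ => P.leafAux_glue) z := by
    rintro _ ⟨a, L, hL, rfl⟩ ⟨p, hp, rfl⟩
    exact (P.leafAux_eq hL hp).symm
  rw [key ω h hz, key ω' h' hz']

/-! ### The charts are injective on leaves -/

/-- The points of a boundary interval, in the disjoint union of the strips. -/
def pts (I : Σ a, (P.S a).Interval) : Set P.Total := (fun x => ⟨I.1, x⟩) '' I.2.toSet

theorem eq_of_mem_pts {I J : Σ a, (P.S a).Interval} {p : P.Total} (hI : p ∈ P.pts I)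
    (hJ : p ∈ P.pts J) : I = J := by
  obtain ⟨a, s, l, r, hm⟩ := I
  obtain ⟨a', s', l', r', hm'⟩ := J
  obtain ⟨x, hx, rfl⟩ := hI
  obtain ⟨y, hy, hxy⟩ := hJ
  obtain rfl : a' = a := congrArg Sigma.fst hxy
  obtain rfl : y = x := eq_of_heq (Sigma.mk.inj hxy).2
  obtain rfl : s = s' := ModelStrip.stripLevel_injective (hx.1.symm.trans hy.1)
  by_cases h : (l, r) = (l', r')
  · obtain ⟨rfl, rfl⟩ := Prod.mk.inj h
    rfl
  · exact absurd (Ioo_subset_Icc_self hy.2)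
      (disjoint_left.1 ((P.S a').disjoint_closures s hm hm' h) (Ioo_subset_Icc_self hx.2))

theorem eq_of_mem_pts_of_eq {I : Σ a, (P.S a).Interval} {p q : P.Total} (hp : p ∈ P.pts I)
    (hq : q ∈ P.pts I) (h : p.2.1.1 = q.2.1.1) : p = q := by
  obtain ⟨x, hx, rfl⟩ := hp
  obtain ⟨y, hy, rfl⟩ := hq
  have : x = y := Subtype.ext (Prod.ext h (hx.1.trans hy.1.symm))
  rw [this]

theorem Glue.spec {P : StrippedSurface A B} {p q : P.Total} (h : P.Glue p q) :
    ∃ b, p ∈ P.pts (P.Y b) ∧ q ∈ P.pts (P.X b) ∧ q.2.1.1 = P.φ b p.2.1.1 := by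
  cases h with
  | mk b t t' h => exact ⟨b, ⟨_, ⟨rfl, t.2⟩, rfl⟩, ⟨_, ⟨rfl, t'.2⟩, rfl⟩, h⟩

theorem X_ne_Y (b b' : B) : P.X b ≠ P.Y b' := fun h =>
  Sum.inl_ne_inr (P.distinct (show Sum.elim P.X P.Y (.inl b) = Sum.elim P.X P.Y (.inr b') from h))

theorem mk_eq_mk {p q : P.Total} (h : Quot.mk P.Glue p = Quot.mk P.Glue q) :
    p = q ∨ P.Glue p q ∨ P.Glue q p := by
  have hgen := Quot.eqvGen_exact h
  clear h
  induction hgen with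
  | rel p q h => exact Or.inr (Or.inl h)
  | refl p => exact Or.inl rfl
  | symm p q _ ih => rcases ih with h | h | h <;> simp [h]
  | trans p q r _ _ ih1 ih2 =>
    rcases ih1 with rfl | h1 | h1
    · exact ih2
    · rcases ih2 with rfl | h2 | h2
      · exact Or.inr (Or.inl h1)
      · obtain ⟨b, -, hb, -⟩ := h1.spec
        obtain ⟨b', hb', -, -⟩ := h2.spec
        exact absurd (P.eq_of_mem_pts hb hb') (P.X_ne_Y b b')
      · obtain ⟨b, hp, hq, e⟩ := h1.spec
        obtain ⟨b', hr, hq', e'⟩ := h2.spec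
        have hb := P.distinct (show Sum.elim P.X P.Y (.inl b) = Sum.elim P.X P.Y (.inl b') from
          P.eq_of_mem_pts hq hq')
        obtain rfl : b = b' := Sum.inl.inj hb
        exact Or.inl (P.eq_of_mem_pts_of_eq hp hr ((P.φ b).injective (e.symm.trans e')))
    · rcases ih2 with rfl | h2 | h2
      · exact Or.inr (Or.inr h1)
      · obtain ⟨b, hq, hp, e⟩ := h1.spec
        obtain ⟨b', hq', hr, e'⟩ := h2.spec
        have hb := P.distinct (show Sum.elim P.X P.Y (.inr b) = Sum.elim P.X P.Y (.inr b') from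
          P.eq_of_mem_pts hq hq')
        obtain rfl : b = b' := Sum.inr.inj hb
        exact Or.inl (P.eq_of_mem_pts_of_eq hp hr (e.trans e'.symm))
      · obtain ⟨b, hb, -, -⟩ := h1.spec
        obtain ⟨b', -, hb', -⟩ := h2.spec
        exact absurd (P.eq_of_mem_pts hb' hb) (P.X_ne_Y b' b)

theorem ξ_injOn_leaf {a : A} {L : Set (P.S a).Pt} (hL : (P.S a).IsLeaf L) :
    InjOn (P.ξ a) L := by
  have key : ∀ p ∈ L, ∀ q ∈ L, ¬ P.Glue ⟨a, p⟩ ⟨a, q⟩ := by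
    intro p hp q hq h
    obtain ⟨b, ⟨x, hx, hxp⟩, hqX, -⟩ := h.spec
    have hpY : (⟨a, p⟩ : P.Total) ∈ P.pts (P.Y b) := ⟨x, hx, hxp⟩
    have hYa : (P.Y b).1 = a := congrArg Sigma.fst hxp
    generalize hI : P.Y b = I at *
    obtain ⟨c, I⟩ := I
    obtain rfl : c = a := hYa
    obtain rfl : x = p := eq_of_heq (Sigma.mk.inj hxp).2
    have hLI : L = I.toSet := hL.eq_of_mem (Or.inr ⟨I, rfl⟩) hp hx
    have hqY : (⟨c, q⟩ : P.Total) ∈ P.pts ⟨c, I⟩ := ⟨q, hLI ▸ hq, rfl⟩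
    exact P.X_ne_Y b b ((P.eq_of_mem_pts hqX hqY).trans hI.symm)
  intro p hp q hq h
  rcases P.mk_eq_mk h with h | h | h
  · exact eq_of_heq (Sigma.mk.inj h).2
  · exact absurd h (key p hp q hq)
  · exact absurd h (key q hq p hp)

/-! ### Groups of homeomorphisms -/

/-- The group `𝓗(F_Z)` of all homeomorphisms of `Z` that map leaves onto leaves. -/
def homeoGroup : Subgroup (P.Z ≃ₜ P.Z) where
  carrier := {h | ∀ ω, P.IsLeaf ω → P.IsLeaf (h '' ω)}
  one_mem' := fun ω hω => by
    have h : (⇑(1 : P.Z ≃ₜ P.Z)) '' ω = ω := image_id ω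
    rwa [h]
  mul_mem' := fun {f g} hf hg ω hω => by
    have h : (⇑(f * g)) '' ω = f '' (g '' ω) := image_comp f g ω
    rw [h]
    exact hf _ (hg _ hω)
  inv_mem' := fun {f} hf ω hω => by
    have hne : ω.Nonempty := by
      obtain ⟨a, L, ⟨y, hy, rfl⟩ | ⟨I, rfl⟩, rfl⟩ := hω
      · exact ⟨_, ⟨⟨(0, y), Or.inl hy⟩, rfl, rfl⟩⟩
      · obtain ⟨t, ht⟩ := exists_between ((P.S a).lt_of_mem _ _ I.mem)
        exact ⟨_, ⟨I.point ⟨t, ht⟩, ⟨rfl, ht⟩, rfl⟩⟩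
    obtain ⟨z, hz⟩ := hne
    obtain ⟨η, hη, hzη⟩ := P.exists_isLeaf_mem (f.symm z)
    have h : f '' η = ω := (hf η hη).eq_of_mem hω ⟨_, hzη, f.apply_symm_apply z⟩ hz
    have h2 : (⇑(f⁻¹)) '' ω = η := by
      rw [← h]
      exact f.toEquiv.symm_image_image η
    rwa [h2]

/-- The compact-open topology on `𝓗(F_Z)`. -/
instance : TopologicalSpace P.homeoGroup :=
  TopologicalSpace.induced (fun h => (⟨h.1, h.1.continuous⟩ : C(P.Z, P.Z))) inferInstance

/-- The identity path component `𝓗₀(F_Z)` of `𝓗(F_Z)`. -/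
def homeoGroup₀ : Set P.homeoGroup := pathComponent 1

/-- `h` maps the leaf `ω` onto itself and preserves its orientation: in each chart in which `ω` is
seen, the restriction of `h` to `ω` is increasing in the first coordinate. -/
def PreservesOrientedLeaf (h : P.Z ≃ₜ P.Z) (ω : Set P.Z) : Prop :=
  h '' ω = ω ∧
    ∀ a, ∀ L, (P.S a).IsLeaf L → P.ξ a '' L = ω → ∀ p ∈ L, ∀ q ∈ L, ∀ p' ∈ L, ∀ q' ∈ L,
      h (P.ξ a p) = P.ξ a p' → h (P.ξ a q) = P.ξ a q' → (p.1.1 < q.1.1 ↔ p'.1.1 < q'.1.1)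

/-- The subgroup `𝓗₀(F_Z)'` of the homeomorphisms that map each leaf onto itself and preserve its
orientation. -/
def homeoGroup₀' : Subgroup P.homeoGroup where
  carrier := {h | ∀ ω, P.IsLeaf ω → P.PreservesOrientedLeaf h.1 ω}
  one_mem' := fun ω _ => by
    refine ⟨image_id ω, fun a L hL _ p hp q hq p' hp' q' hq' h1 h2 => ?_⟩
    rw [P.ξ_injOn_leaf hL hp hp' h1, P.ξ_injOn_leaf hL hq hq' h2]
  mul_mem' := fun {f g} hf hg ω hω => by
    refine ⟨?_, fun a L hL hLω p hp q hq p' hp' q' hq' h1 h2 => ?_⟩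
    · have h : (⇑(f.1 * g.1)) '' ω = f.1 '' (g.1 '' ω) := image_comp f.1 g.1 ω
      exact h.trans (by rw [(hg ω hω).1, (hf ω hω).1])
    · have hmem : ∀ x ∈ L, ∃ y ∈ L, P.ξ a y = g.1 (P.ξ a x) := fun x hx => by
        have : g.1 (P.ξ a x) ∈ P.ξ a '' L := by
          rw [hLω, ← (hg ω hω).1]
          exact mem_image_of_mem _ (hLω ▸ mem_image_of_mem _ hx)
        exact this
      obtain ⟨x, hx, hxp⟩ := hmem p hp
      obtain ⟨y, hy, hyq⟩ := hmem q hq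
      have h1' : f.1 (P.ξ a x) = P.ξ a p' := by rw [hxp]; exact h1
      have h2' : f.1 (P.ξ a y) = P.ξ a q' := by rw [hyq]; exact h2
      exact ((hg ω hω).2 a L hL hLω p hp q hq x hx y hy hxp.symm hyq.symm).trans
        ((hf ω hω).2 a L hL hLω x hx y hy p' hp' q' hq' h1' h2')
  inv_mem' := fun {f} hf ω hω => by
    refine ⟨?_, fun a L hL hLω p hp q hq p' hp' q' hq' h1 h2 => ?_⟩
    · have h := f.1.toEquiv.symm_image_image ω
      have h' : f.1.toEquiv '' ω = ω := (hf ω hω).1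
      rwa [h'] at h
    · have h1' : f.1 (P.ξ a p') = P.ξ a p := by rw [← h1]; exact f.1.apply_symm_apply _
      have h2' : f.1 (P.ξ a q') = P.ξ a q := by rw [← h2]; exact f.1.apply_symm_apply _
      exact ((hf ω hω).2 a L hL hLω p' hp' q' hq' p hp q hq h1' h2').symm

/-- A lift of `h` to the model strip `S a`: a homeomorphism `g` of `S a` with `ξ ∘ g = h ∘ ξ`. -/
def IsLift (h : P.Z ≃ₜ P.Z) (a : A) (g : (P.S a).Pt ≃ₜ (P.S a).Pt) : Prop :=
  ∀ p, P.ξ a (g p) = h (P.ξ a p)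

/-- `g(x, y) = (lam(x, y), mu(y))` on the model strip `S`. -/
def HasForm {S : ModelStrip} (g : S.Pt ≃ₜ S.Pt) (lam : C(S.Pt, ℝ))
    (mu : Icc (-1 : ℝ) 1 ≃ₜ Icc (-1 : ℝ) 1) : Prop :=
  ∀ p : S.Pt, ∀ y : Icc (-1 : ℝ) 1, p.1.2 = y → (g p).1 = (lam p, (mu y : ℝ))

/-- `lam(x, y)` is increasing in `x` for each fixed `y ∈ (-1, 1)`. -/
def IncreasingOnLines {S : ModelStrip} (lam : C(S.Pt, ℝ)) : Prop :=
  ∀ p q : S.Pt, p.1.2 = q.1.2 → p.1.2 ∈ Ioo (-1 : ℝ) 1 → p.1.1 < q.1.1 → lam p < lam q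

end StrippedSurface

/-- The subset `D` of the space `T` is a strong deformation retract of the subset `E`. -/
def IsStrongDeformationRetract {T : Type*} [TopologicalSpace T] (D E : Set T) : Prop :=
  D ⊆ E ∧ ∃ r : C(E, E), (∀ x, (r x : T) ∈ D) ∧
    (ContinuousMap.id E).HomotopicRel r {x : E | (x : T) ∈ D}

/-!
A homeomorphism of a reduced stripped surface that preserves the foliation and each strip is studied
through its lifts to the model strips.

The quotient map from the disjoint union of the strips onto the surface is closed with finite
fibres, hence proper (`isClosedMap_proj`), because the glued intervals form a locally finite family
of closed sets. Two general facts about lifting through such maps are used: partial lifts over a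
dense set that does not locally disconnect the space extend continuously
(`exists_continuous_lift`), and families of lifts are jointly continuous
(`continuous_uncurry_of_lift`).

The points of the open strips `ℝ × (-1, 1)` have a description in terms of the foliation: their
leaves are separated from all other leaves by saturated open sets, and they cut their small
saturated neighbourhoods (`Regular`). That no boundary leaf or glued leaf has both properties is
where reducedness enters (`not_regular_of_mem_bdLeaf`). So leaf-preserving homeomorphisms preserve the
union of the open strips; if a strip is preserved, the homeomorphism lifts over the open strip,
and the lift extends to the boundary intervals (`exists_isLift`, `IsLift.exists_hasForm`).

The conditions of the characterization say exactly that all lifts are monotone maps of the strips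
(`MonoMap`, `MonoLift`); the point is that a lift cannot exchange two glued intervals of one side
(`IsLift.mapsTo_interval`). Along a path from the identity, points stay in their open strips and in
their leaves in the boundaries of the strips, and the order of two points of a leaf, or of two lines, cannot change; hence
the identity path component consists of maps with monotone lifts (`exists_monoLift_of_path`).
Conversely, monotone maps are deformed to the identity by straight lines, with independent
parameters for the two coordinates (`MonoMap.interp`). This is compatible with the gluing since the
gluing maps are affine, and it is jointly continuous in the homeomorphism and the parameters
(`continuous_deform`). Deforming both coordinates contracts the component, and deforming the second
one alone retracts it onto the subgroup of the maps that preserve every leaf.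
-/

/-! ### The topology of a model strip -/

namespace ModelStrip

variable {S : ModelStrip}

/-- The open strip `ℝ × (-1, 1)` inside a model strip. -/
def inner (S : ModelStrip) : Set S.Pt := {p | p.1.2 ∈ Ioo (-1 : ℝ) 1}

theorem stripLevel_mem_Icc (s : Bool) : stripLevel s ∈ Icc (-1 : ℝ) 1 := by
  cases s <;> simp [stripLevel]

theorem eq_stripLevel_of_mem_Icc {y : ℝ} (hy : y ∈ Icc (-1 : ℝ) 1) (hy' : y ∉ Ioo (-1 : ℝ) 1) :
    ∃ s, y = stripLevel s := by
  by_cases h : y = 1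
  · exact ⟨true, by simp [stripLevel, h]⟩
  · refine ⟨false, ?_⟩
    by_contra h2
    have h2' : y ≠ -1 := by simpa [stripLevel] using h2
    exact hy' ⟨lt_of_le_of_ne hy.1 h2'.symm, lt_of_le_of_ne hy.2 h⟩

theorem mem_Icc (p : S.Pt) : p.1.2 ∈ Icc (-1 : ℝ) 1 := by
  rcases p.2 with h | ⟨s, h, -⟩
  · exact Ioo_subset_Icc_self h
  · rw [h]; exact stripLevel_mem_Icc s

theorem exists_interval {p : S.Pt} {s : Bool} (hs : p.1.2 = stripLevel s) :
    ∃ I : S.Interval, I.side = s ∧ p ∈ I.toSet := by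
  rcases p.2 with h | ⟨s', h, i, hi, hpi⟩
  · exact absurd (hs ▸ h) (stripLevel_not_mem s)
  · obtain rfl := stripLevel_injective (hs.symm.trans h)
    exact ⟨⟨s, i.1, i.2, hi⟩, rfl, hs, hpi⟩

theorem exists_interval_of_notMem {p : S.Pt} (hp : p ∉ S.inner) :
    ∃ I : S.Interval, p ∈ I.toSet := by
  obtain ⟨s, hs⟩ := eq_stripLevel_of_mem_Icc (mem_Icc p) hp
  obtain ⟨I, -, h⟩ := exists_interval hs
  exact ⟨I, h⟩

theorem Interval.notMem_inner {I : S.Interval} {p : S.Pt} (hp : p ∈ I.toSet) : p ∉ S.inner :=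
  fun h => stripLevel_not_mem I.side (by rw [← hp.1]; exact h)

theorem Interval.isLeaf (I : S.Interval) : S.IsLeaf I.toSet := Or.inr ⟨I, rfl⟩

theorem isLeaf_line {y : ℝ} (hy : y ∈ Ioo (-1 : ℝ) 1) : S.IsLeaf {p : S.Pt | p.1.2 = y} :=
  Or.inl ⟨y, hy, rfl⟩

/-- Intervals on one side of a strip that have a common point in their closures are equal. -/
theorem Interval.eq_of_mem_Icc {I J : S.Interval} (hs : I.side = J.side) {x : ℝ}
    (hI : x ∈ Icc I.left I.right) (hJ : x ∈ Icc J.left J.right) : I = J := by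
  obtain ⟨s, l, r, hm⟩ := I
  obtain ⟨s', l', r', hm'⟩ := J
  obtain rfl : s = s' := hs
  by_cases h : (l, r) = (l', r')
  · obtain ⟨rfl, rfl⟩ := Prod.mk.inj h
    rfl
  · exact absurd hJ (disjoint_left.1 (S.disjoint_closures s hm hm' h) hI)

theorem Interval.eq_of_mem {I J : S.Interval} {p : S.Pt} (hI : p ∈ I.toSet) (hJ : p ∈ J.toSet) :
    I = J :=
  Interval.eq_of_mem_Icc (stripLevel_injective (hI.1.symm.trans hJ.1))
    (Ioo_subset_Icc_self hI.2) (Ioo_subset_Icc_self hJ.2)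

theorem Interval.nonempty (I : S.Interval) : I.toSet.Nonempty := by
  obtain ⟨t, ht⟩ := exists_between (S.lt_of_mem _ _ I.mem)
  exact ⟨I.point ⟨t, ht⟩, rfl, ht⟩

theorem IsLeaf.snd_eq {L : Set S.Pt} (hL : S.IsLeaf L) {p q : S.Pt} (hp : p ∈ L) (hq : q ∈ L) :
    p.1.2 = q.1.2 := by
  rcases hL with ⟨y, hy, rfl⟩ | ⟨I, rfl⟩
  · exact Eq.trans hp (Eq.symm hq)
  · exact hp.1.trans hq.1.symm

theorem IsLeaf.eq_or_lt_or_gt {L : Set S.Pt} (hL : S.IsLeaf L) {p q : S.Pt} (hp : p ∈ L)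
    (hq : q ∈ L) : p = q ∨ p.1.1 < q.1.1 ∨ q.1.1 < p.1.1 := by
  rcases lt_trichotomy p.1.1 q.1.1 with h | h | h
  · exact Or.inr (Or.inl h)
  · exact Or.inl (Subtype.ext (Prod.ext h (hL.snd_eq hp hq)))
  · exact Or.inr (Or.inr h)

/-- A model strip is open in `ℝ × [-1, 1]`. -/
theorem exists_box_subset (p : S.Pt) : ∃ ε > 0, ∀ x y : ℝ, |x - p.1.1| < ε → |y - p.1.2| < ε →
    y ∈ Icc (-1 : ℝ) 1 → (x, y) ∈ S.carrier := by
  by_cases hp : p ∈ S.inner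
  · have hp1 : -1 < p.1.2 := hp.1
    have hp2 : p.1.2 < 1 := hp.2
    refine ⟨min (p.1.2 + 1) (1 - p.1.2), lt_min (by linarith) (by linarith), ?_⟩
    intro x y _ hy _
    have h1 := hy.trans_le (min_le_left _ _)
    have h2 := hy.trans_le (min_le_right _ _)
    rw [abs_lt] at h1 h2
    exact Or.inl ⟨by show -1 < y; linarith, by show y < 1; linarith⟩
  · obtain ⟨I, hI⟩ := exists_interval_of_notMem hp
    have h1 := hI.2.1
    have h2 := hI.2.2
    refine ⟨min 1 (min (p.1.1 - I.left) (I.right - p.1.1)),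
      lt_min one_pos (lt_min (by linarith) (by linarith)), ?_⟩
    intro x y hx hy hy'
    by_cases hyo : y ∈ Ioo (-1 : ℝ) 1
    · exact Or.inl hyo
    · obtain ⟨s, hs⟩ := eq_stripLevel_of_mem_Icc hy' hyo
      have hx1 := hx.trans_le ((min_le_right _ _).trans (min_le_left _ _))
      have hx2 := hx.trans_le ((min_le_right _ _).trans (min_le_right _ _))
      rw [abs_lt] at hx1 hx2
      have hy1 := hy.trans_le (min_le_left _ _)
      have hss : s = I.side := by
        rw [hs, hI.1] at hy1
        cases s <;> cases h : I.side <;> simp [h, stripLevel] at hy1 ⊢ <;> norm_num at hy1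
      exact Or.inr ⟨I.side, hss ▸ hs, (I.left, I.right), I.mem, by show _ < x; linarith,
        by show x < _; linarith⟩

theorem mem_nhds_iff {p : S.Pt} {N : Set S.Pt} : N ∈ 𝓝 p ↔ ∃ ε > 0, ∀ x y : ℝ, |x - p.1.1| < ε →
    |y - p.1.2| < ε → y ∈ Icc (-1 : ℝ) 1 → ∃ h : (x, y) ∈ S.carrier, (⟨(x, y), h⟩ : S.Pt) ∈ N := by
  rw [Metric.mem_nhds_iff]
  constructor
  · rintro ⟨ε, hε, h⟩
    obtain ⟨δ, hδ, hS⟩ := exists_box_subset p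
    refine ⟨min ε δ, lt_min hε hδ, fun x y hx hy hy' => ?_⟩
    have hm := hS x y (hx.trans_le (min_le_right _ _)) (hy.trans_le (min_le_right _ _)) hy'
    refine ⟨hm, h ?_⟩
    rw [Metric.mem_ball, Subtype.dist_eq, Prod.dist_eq]
    exact max_lt (hx.trans_le (min_le_left _ _)) (hy.trans_le (min_le_left _ _))
  · rintro ⟨ε, hε, h⟩
    refine ⟨ε, hε, fun q hq => ?_⟩
    rw [Metric.mem_ball, Subtype.dist_eq, Prod.dist_eq] at hq
    obtain ⟨_, h2⟩ := h q.1.1 q.1.2 ((le_max_left _ _).trans_lt hq) ((le_max_right _ _).trans_lt hq)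
      (mem_Icc q)
    exact h2

theorem isOpen_inner : IsOpen S.inner :=
  isOpen_Ioo.preimage (continuous_snd.comp continuous_subtype_val)

theorem isPreconnected_of_convex {C : Set (ℝ × ℝ)} (hC : Convex ℝ C)
    (hC' : C ⊆ S.carrier) : IsPreconnected {p : S.Pt | p.1 ∈ C} := by
  rw [← IsInducing.subtypeVal.isPreconnected_image]
  convert hC.isPreconnected using 1
  ext z
  constructor
  · rintro ⟨p, hp, rfl⟩
    exact hp
  · exact fun hz => ⟨⟨z, hC' hz⟩, hz, rfl⟩

theorem isPreconnected_levels {c d : ℝ} (hc : -1 ≤ c) (hd : d ≤ 1) :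
    IsPreconnected {p : S.Pt | p.1.2 ∈ Ioo c d} := by
  refine isPreconnected_of_convex (C := {z | z.2 ∈ Ioo c d}) ?_
    fun z hz => Or.inl ⟨hc.trans_lt hz.1, hz.2.trans_le hd⟩
  exact (convex_Ioo c d).linear_preimage (LinearMap.snd ℝ ℝ ℝ)

/-- Horizontal segments of a strip are connected. -/
theorem isPreconnected_horizontal {C : Set ℝ} (hC : Convex ℝ C) {y : ℝ}
    (hC' : ∀ x ∈ C, (x, y) ∈ S.carrier) : IsPreconnected {p : S.Pt | p.1.1 ∈ C ∧ p.1.2 = y} :=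
  isPreconnected_of_convex (C := C ×ˢ {y}) (hC.prod (convex_singleton y)) fun z hz => by
    have h2 : z.2 = y := hz.2
    rw [← Prod.mk.eta (p := z), h2]
    exact hC' _ hz.1

theorem IsLeaf.isPreconnected {L : Set S.Pt} (hL : S.IsLeaf L) : IsPreconnected L := by
  rcases hL with ⟨y, hy, rfl⟩ | ⟨I, rfl⟩
  · simpa using isPreconnected_horizontal (S := S) convex_univ (y := y) fun x _ => Or.inl hy
  · have := isPreconnected_horizontal (S := S) (convex_Ioo I.left I.right)
      (y := stripLevel I.side) fun x hx => Or.inr ⟨I.side, rfl, _, I.mem, hx⟩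
    convert this using 1
    ext p
    exact and_comm

/-- The point at the fraction `t` of the way from `p` to the middle line of the strip. -/
def push (p : S.Pt) (t : Icc (0 : ℝ) 1) : S.Pt :=
  ⟨(p.1.1, (1 - t) * p.1.2), by
    by_cases ht : (t : ℝ) = 0
    · simp [ht]
    · have h := mem_Icc p
      have h0 : 0 < (t : ℝ) := lt_of_le_of_ne t.2.1 (Ne.symm ht)
      have h1 := t.2.2
      exact Or.inl ⟨by show -1 < (1 - (t : ℝ)) * p.1.2; nlinarith [h.1, h.2],
        by show (1 - (t : ℝ)) * p.1.2 < 1; nlinarith [h.1, h.2]⟩⟩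

theorem push_mem_inner (p : S.Pt) {t : Icc (0 : ℝ) 1} (ht : 0 < t) : push p t ∈ S.inner := by
  have h := mem_Icc p
  have h0 : 0 < (t : ℝ) := ht
  have h1 := t.2.2
  exact ⟨by show -1 < (1 - (t : ℝ)) * p.1.2; nlinarith [h.1, h.2],
    by show (1 - (t : ℝ)) * p.1.2 < 1; nlinarith [h.1, h.2]⟩

theorem push_zero (p : S.Pt) : push p 0 = p := Subtype.ext (Prod.ext rfl (by simp [push]))

theorem continuous_push (p : S.Pt) : Continuous (push p) := by
  unfold push
  fun_prop

instance neBot_nhdsGT_zero : (𝓝[>] (0 : Icc (0 : ℝ) 1)).NeBot :=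
  nhdsGT_neBot_of_exists_gt ⟨1, zero_lt_one⟩

theorem tendsto_push (p : S.Pt) : Filter.Tendsto (push p) (𝓝[>] 0) (𝓝 p) := by
  have h := (continuous_push p).tendsto 0
  rw [push_zero] at h
  exact h.mono_left nhdsWithin_le_nhds

theorem dense_inner : Dense S.inner := fun p =>
  mem_closure_of_tendsto (tendsto_push p)
    (Filter.eventually_of_mem self_mem_nhdsWithin fun _ ht => push_mem_inner p ht)

/-- Small balls of a strip are connected, even after removing the two sides. -/
theorem exists_nhds_subset_isPreconnected {p : S.Pt} {N : Set S.Pt} (hN : N ∈ 𝓝 p) :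
    ∃ H ∈ 𝓝 p, H ⊆ N ∧ IsPreconnected (H ∩ S.inner) ∧ IsPreconnected H := by
  obtain ⟨ε, hε, h⟩ := Metric.mem_nhds_iff.1 hN
  have hconn : IsPreconnected (Metric.ball p ε ∩ S.inner) := by
    have h1 := isPreconnected_of_convex (S := S)
      (C := Metric.ball p.1 ε ∩ {z | z.2 ∈ Ioo (-1 : ℝ) 1})
      ((convex_ball p.1 ε).inter ((convex_Ioo (-1) 1).linear_preimage (LinearMap.snd ℝ ℝ ℝ)))
      fun z hz => Or.inl hz.2
    exact h1
  exact ⟨_, Metric.ball_mem_nhds p hε, h, hconn, hconn.subset_closure inter_subset_left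
    (dense_inner.open_subset_closure_inter Metric.isOpen_ball)⟩

theorem Interval.toSet_eq (I : S.Interval) :
    I.toSet = {p : S.Pt | p.1.2 = stripLevel I.side ∧ p.1.1 ∈ Icc I.left I.right} := by
  ext p
  refine ⟨fun h => ⟨h.1, Ioo_subset_Icc_self h.2⟩, fun h => ?_⟩
  obtain ⟨J, hJs, hJ⟩ := exists_interval h.1
  rwa [← Interval.eq_of_mem_Icc hJs (Ioo_subset_Icc_self hJ.2) h.2]

/-- Boundary intervals are closed in the strip: their end points do not belong to it, as the
closures of the intervals are disjoint. -/
theorem Interval.isClosed (I : S.Interval) : IsClosed I.toSet := by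
  rw [I.toSet_eq]
  exact (isClosed_eq (by fun_prop) continuous_const).inter
    (isClosed_Icc.preimage (by fun_prop))

theorem Interval.inner_union_mem_nhds {I : S.Interval} {p : S.Pt} (hp : p ∈ I.toSet) :
    S.inner ∪ I.toSet ∈ 𝓝 p := by
  have h1 : ∀ᶠ q : S.Pt in 𝓝 p, q.1.1 ∈ Ioo I.left I.right :=
    (continuous_fst.comp continuous_subtype_val).continuousAt.eventually (isOpen_Ioo.mem_nhds hp.2)
  have h2 : ∀ᶠ q : S.Pt in 𝓝 p, q.1.2 ≠ stripLevel (!I.side) := by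
    refine (continuous_snd.comp continuous_subtype_val).continuousAt.eventually_ne ?_
    show p.1.2 ≠ _
    rw [hp.1]
    exact fun h => by simpa using stripLevel_injective h
  filter_upwards [h1, h2] with q hq1 hq2
  by_cases hq : q ∈ S.inner
  · exact Or.inl hq
  · obtain ⟨s, hs⟩ := eq_stripLevel_of_mem_Icc (mem_Icc q) hq
    have : s = I.side := by
      cases s <;> cases h : I.side <;> simp_all
    exact Or.inr ⟨this ▸ hs, hq1⟩

/-- Near a point of a leaf, the points of the same height belong to that leaf. -/
theorem IsLeaf.eventually_mem {L : Set S.Pt} (hL : S.IsLeaf L) {p : S.Pt} (hp : p ∈ L) :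
    ∀ᶠ q in 𝓝 p, q.1.2 = p.1.2 → q ∈ L := by
  rcases hL with ⟨y, hy, rfl⟩ | ⟨I, rfl⟩
  · exact Filter.Eventually.of_forall fun q hq => hq.trans hp
  · filter_upwards [Interval.inner_union_mem_nhds hp] with q hq hqp
    refine hq.resolve_left fun h => stripLevel_not_mem I.side ?_
    rw [← hp.1, ← hqp]
    exact h

/-- The boundary intervals form a locally finite family: a point has a neighbourhood that meets at
most one of them. -/
theorem exists_nhds_subsingleton (p : S.Pt) : ∃ N ∈ 𝓝 p, ∀ I J : S.Interval,
    (I.toSet ∩ N).Nonempty → (J.toSet ∩ N).Nonempty → I = J := by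
  by_cases hp : p ∈ S.inner
  · exact ⟨_, isOpen_inner.mem_nhds hp, fun I J ⟨q, hq, hq'⟩ => absurd hq' (I.notMem_inner hq)⟩
  · obtain ⟨K, hK⟩ := exists_interval_of_notMem hp
    refine ⟨_, Interval.inner_union_mem_nhds hK, ?_⟩
    have key : ∀ I : S.Interval, (I.toSet ∩ (S.inner ∪ K.toSet)).Nonempty → I = K := by
      rintro I ⟨q, hq, hq' | hq'⟩
      · exact absurd hq' (I.notMem_inner hq)
      · exact Interval.eq_of_mem hq hq'
    exact fun I J hI hJ => (key I hI).trans (key J hJ).symm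

end ModelStrip

/-! ### The topology of a stripped surface -/

namespace StrippedSurface

variable {A : Type u} {B : Type v} (P : StrippedSurface A B)

/-- The quotient map from the disjoint union of the strips onto the surface. -/
def proj : P.Total → P.Z := Quot.mk P.Glue

theorem proj_mk (a : A) (p : (P.S a).Pt) : P.proj ⟨a, p⟩ = P.ξ a p := rfl

theorem isQuotientMap_proj : IsQuotientMap P.proj := isQuotientMap_quot_mk

theorem continuous_proj : Continuous P.proj := P.isQuotientMap_proj.continuous

theorem proj_surjective : Function.Surjective P.proj := P.isQuotientMap_proj.surjective

theorem continuous_ξ (a : A) : Continuous (P.ξ a) := P.continuous_proj.comp continuous_sigmaMk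

theorem exists_ξ_eq (z : P.Z) : ∃ a p, P.ξ a p = z := by
  obtain ⟨⟨a, p⟩, h⟩ := P.proj_surjective z
  exact ⟨a, p, h⟩

variable {P}

/-- Two boundary intervals are glued to one another. -/
def Glued (I J : Σ a, (P.S a).Interval) : Prop :=
  ∃ b, (I = P.Y b ∧ J = P.X b) ∨ (I = P.X b ∧ J = P.Y b)

theorem Glued.symm {I J : Σ a, (P.S a).Interval} (h : Glued I J) : Glued J I := by
  obtain ⟨b, h | h⟩ := h
  · exact ⟨b, Or.inr h.symm⟩
  · exact ⟨b, Or.inl h.symm⟩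

theorem Glued.bdLeaf_eq {I J : Σ a, (P.S a).Interval} (h : Glued I J) :
    P.bdLeaf I = P.bdLeaf J := by
  obtain ⟨b, ⟨rfl, rfl⟩ | ⟨rfl, rfl⟩⟩ := h
  · exact P.bdLeaf_eq b
  · exact (P.bdLeaf_eq b).symm

theorem X_injective : Function.Injective P.X := fun b b' h =>
  Sum.inl.inj (P.distinct (show Sum.elim P.X P.Y (.inl b) = Sum.elim P.X P.Y (.inl b') from h))

theorem Y_injective : Function.Injective P.Y := fun b b' h =>
  Sum.inr.inj (P.distinct (show Sum.elim P.X P.Y (.inr b) = Sum.elim P.X P.Y (.inr b') from h))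

theorem Glued.ne {I J : Σ a, (P.S a).Interval} (h : Glued I J) : I ≠ J := by
  obtain ⟨b, ⟨rfl, rfl⟩ | ⟨rfl, rfl⟩⟩ := h
  · exact (P.X_ne_Y b b).symm
  · exact P.X_ne_Y b b

theorem Glued.unique {I J K : Σ a, (P.S a).Interval} (h : Glued I J) (h' : Glued I K) :
    J = K := by
  obtain ⟨b, ⟨h1, rfl⟩ | ⟨h1, rfl⟩⟩ := h <;> obtain ⟨b', ⟨h2, rfl⟩ | ⟨h2, rfl⟩⟩ := h'
  · rw [Y_injective (h1.symm.trans h2)]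
  · exact absurd (h2.symm.trans h1) (P.X_ne_Y b' b)
  · exact absurd (h1.symm.trans h2) (P.X_ne_Y b b')
  · rw [X_injective (h1.symm.trans h2)]

theorem Glue.glued {p q : P.Total} (h : P.Glue p q) :
    ∃ I J, Glued I J ∧ p ∈ P.pts I ∧ q ∈ P.pts J := by
  obtain ⟨b, hp, hq, -⟩ := h.spec
  exact ⟨_, _, ⟨b, Or.inl ⟨rfl, rfl⟩⟩, hp, hq⟩

theorem proj_eq {p q : P.Total} (h : P.proj p = P.proj q) :
    p = q ∨ ∃ I J, Glued I J ∧ p ∈ P.pts I ∧ q ∈ P.pts J := by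
  rcases P.mk_eq_mk h with h | h | h
  · exact Or.inl h
  · exact Or.inr h.glued
  · obtain ⟨I, J, hIJ, h1, h2⟩ := h.glued
    exact Or.inr ⟨J, I, hIJ.symm, h2, h1⟩

theorem mem_pts_mk {I : Σ a, (P.S a).Interval} {a : A} {p : (P.S a).Pt}
    (h : (⟨a, p⟩ : P.Total) ∈ P.pts I) :
    ∃ J : (P.S a).Interval, I = ⟨a, J⟩ ∧ p ∈ J.toSet := by
  obtain ⟨c, J⟩ := I
  obtain ⟨x, hx, hxp⟩ := h
  obtain rfl : c = a := congrArg Sigma.fst hxp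
  obtain rfl : x = p := eq_of_heq (Sigma.mk.inj hxp).2
  exact ⟨J, rfl, hx⟩

theorem mk_mem_pts {a : A} {p : (P.S a).Pt} {J : (P.S a).Interval} (h : p ∈ J.toSet) :
    (⟨a, p⟩ : P.Total) ∈ P.pts ⟨a, J⟩ := ⟨p, h, rfl⟩

theorem proj_mem_bdLeaf {I : Σ a, (P.S a).Interval} {x : P.Total} (h : x ∈ P.pts I) :
    P.proj x ∈ P.bdLeaf I := by
  obtain ⟨p, hp, rfl⟩ := h
  exact ⟨p, hp, rfl⟩

theorem mem_bdLeaf {I : Σ a, (P.S a).Interval} {x : P.Total} (h : P.proj x ∈ P.bdLeaf I) :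
    x ∈ P.pts I ∨ ∃ J, Glued I J ∧ x ∈ P.pts J := by
  obtain ⟨p, hp, hpx⟩ := h
  rcases proj_eq (P := P) (p := ⟨I.1, p⟩) (q := x) hpx with rfl | ⟨I', J, hIJ, h1, h2⟩
  · exact Or.inl ⟨p, hp, rfl⟩
  · obtain rfl := P.eq_of_mem_pts h1 ⟨p, hp, rfl⟩
    exact Or.inr ⟨J, hIJ, h2⟩

theorem isLeaf_bdLeaf (I : Σ a, (P.S a).Interval) : P.IsLeaf (P.bdLeaf I) :=
  ⟨I.1, _, I.2.isLeaf, rfl⟩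

/-- A point of an open strip is not identified with any other point. -/
theorem eq_of_ξ_eq {a b : A} {p : (P.S a).Pt} {q : (P.S b).Pt} (hp : p ∈ (P.S a).inner)
    (h : P.ξ b q = P.ξ a p) : (⟨b, q⟩ : P.Total) = ⟨a, p⟩ := by
  rcases proj_eq (P := P) (p := ⟨b, q⟩) (q := ⟨a, p⟩) h with h | ⟨I, J, -, -, h⟩
  · exact h
  · obtain ⟨K, -, hK⟩ := mem_pts_mk h
    exact absurd hp (K.notMem_inner hK)

theorem eq_of_ξ_eq' {a : A} {p q : (P.S a).Pt} (hp : p ∈ (P.S a).inner)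
    (h : P.ξ a q = P.ξ a p) : q = p :=
  eq_of_heq (Sigma.mk.inj (eq_of_ξ_eq hp h)).2

theorem finite_fiber (z : P.Z) : (P.proj ⁻¹' {z}).Finite := by
  obtain ⟨x, rfl⟩ := P.proj_surjective z
  have h1 : {y | P.Glue x y}.Subsingleton := by
    intro y hy y' hy'
    obtain ⟨b, hx, h, e⟩ := Glue.spec hy
    obtain ⟨b', hx', h', e'⟩ := Glue.spec hy'
    obtain rfl := Y_injective (P.eq_of_mem_pts hx hx')
    exact P.eq_of_mem_pts_of_eq h h' (e.trans e'.symm)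
  have h2 : {y | P.Glue y x}.Subsingleton := by
    intro y hy y' hy'
    obtain ⟨b, h, hx, e⟩ := Glue.spec hy
    obtain ⟨b', h', hx', e'⟩ := Glue.spec hy'
    obtain rfl := X_injective (P.eq_of_mem_pts hx hx')
    exact P.eq_of_mem_pts_of_eq h h' ((P.φ b).injective (e.symm.trans e'))
  refine ((finite_singleton x).union (h1.finite.union h2.finite)).subset fun y hy => ?_
  rcases P.mk_eq_mk (p := y) (q := x) hy with rfl | h | h
  · exact Or.inl rfl
  · exact Or.inr (Or.inr h)
  · exact Or.inr (Or.inl h)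

theorem finite_fiber_ξ (a : A) (z : P.Z) : (P.ξ a ⁻¹' {z}).Finite :=
  (finite_fiber z).preimage (f := Sigma.mk a) sigma_mk_injective.injOn

theorem locallyFinite_pts {F : B → Σ a, (P.S a).Interval} (hF : Function.Injective F) :
    LocallyFinite fun b => P.pts (F b) := by
  rintro ⟨a, p⟩
  obtain ⟨N, hN, h⟩ := ModelStrip.exists_nhds_subsingleton p
  refine ⟨Sigma.mk a '' N, (IsOpenEmbedding.sigmaMk (i := a)).isOpenMap.image_mem_nhds hN,
    Subsingleton.finite ?_⟩
  rintro b ⟨x, hx, n, hn, rfl⟩ b' ⟨x', hx', n', hn', rfl⟩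
  obtain ⟨I, hI, hnI⟩ := mem_pts_mk hx
  obtain ⟨J, hJ, hnJ⟩ := mem_pts_mk hx'
  obtain rfl := h I J ⟨n, hnI, hn⟩ ⟨n', hnJ, hn'⟩
  exact hF (hI.trans hJ.symm)

theorem isClosedEmbedding_point (I : Σ a, (P.S a).Interval) :
    IsClosedEmbedding fun t => (⟨I.1, I.2.point t⟩ : P.Total) := by
  refine (IsClosedEmbedding.sigmaMk (i := I.1)).comp ⟨?_, ?_⟩
  · refine IsEmbedding.of_comp (g := fun p : (P.S I.1).Pt => p.1.1) ?_ (by fun_prop)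
      IsEmbedding.subtypeVal
    unfold ModelStrip.Interval.point
    fun_prop
  · convert I.2.isClosed using 1
    ext p
    constructor
    · rintro ⟨t, rfl⟩
      exact ⟨rfl, t.2⟩
    · exact fun hp => ⟨⟨p.1.1, hp.2⟩, Subtype.ext (Prod.ext rfl hp.1.symm)⟩

/-- The set of points glued to a closed set by one affine homeomorphism of intervals is closed. -/
theorem isClosed_transport (I J : Σ a, (P.S a).Interval) (f : ℝ ≃ᵃ[ℝ] ℝ)
    (hf : ∀ t ∈ Ioo J.2.left J.2.right, f t ∈ Ioo I.2.left I.2.right) {C : Set P.Total}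
    (hC : IsClosed C) :
    IsClosed ((fun t => (⟨J.1, J.2.point t⟩ : P.Total)) ''
      {t | (⟨I.1, I.2.point ⟨f t, hf t t.2⟩⟩ : P.Total) ∈ C}) := by
  refine (isClosedEmbedding_point J).isClosedMap _ (hC.preimage ?_)
  refine (isClosedEmbedding_point I).continuous.comp (Continuous.subtype_mk ?_ _)
  exact (AffineMap.continuous_of_finiteDimensional f.toAffineMap).comp continuous_subtype_val

/-- The quotient map is closed, because the glued intervals form a locally finite family of closed
sets. As its fibres are finite, it is a proper map. -/
theorem isClosedMap_proj : IsClosedMap P.proj := by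
  intro C hC
  rw [← P.isQuotientMap_proj.isClosed_preimage]
  have hXY : ∀ b, ∀ t ∈ Ioo (P.X b).2.left (P.X b).2.right,
      (P.φ b).symm t ∈ Ioo (P.Y b).2.left (P.Y b).2.right := by
    intro b t ht
    obtain ⟨t', ht', rfl⟩ := (P.φ_image b).symm ▸ ht
    simpa using ht'
  have hYX : ∀ b, ∀ t ∈ Ioo (P.Y b).2.left (P.Y b).2.right,
      P.φ b t ∈ Ioo (P.X b).2.left (P.X b).2.right := fun b t ht =>
    P.φ_image b ▸ mem_image_of_mem _ ht
  have h1 := ((locallyFinite_pts (P := P) X_injective).subset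
    (g := fun b => (fun t => (⟨(P.X b).1, (P.X b).2.point t⟩ : P.Total)) ''
      {t | (⟨(P.Y b).1, (P.Y b).2.point ⟨(P.φ b).symm t, hXY b t t.2⟩⟩ : P.Total) ∈ C})
    (by rintro b _ ⟨t, -, rfl⟩; exact mk_mem_pts ⟨rfl, t.2⟩)).isClosed_iUnion
    fun b => isClosed_transport (P.Y b) (P.X b) _ (hXY b) hC
  have h2 := ((locallyFinite_pts (P := P) Y_injective).subset
    (g := fun b => (fun t => (⟨(P.Y b).1, (P.Y b).2.point t⟩ : P.Total)) ''
      {t | (⟨(P.X b).1, (P.X b).2.point ⟨P.φ b t, hYX b t t.2⟩⟩ : P.Total) ∈ C})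
    (by rintro b _ ⟨t, -, rfl⟩; exact mk_mem_pts ⟨rfl, t.2⟩)).isClosed_iUnion
    fun b => isClosed_transport (P.X b) (P.Y b) _ (hYX b) hC
  convert hC.union (h1.union h2) using 1
  ext y
  simp only [mem_preimage, mem_union, mem_iUnion]
  constructor
  · rintro ⟨x, hx, hxy⟩
    rcases P.mk_eq_mk hxy with rfl | h | h
    · exact Or.inl hx
    · refine Or.inr (Or.inl ?_)
      cases h with
      | mk b t t' h =>
        refine ⟨b, t', ?_, rfl⟩
        have : (⟨(P.φ b).symm t', hXY b t' t'.2⟩ : Ioo (P.Y b).2.left (P.Y b).2.right) = t :=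
          Subtype.ext (by simp [h])
        show _ ∈ C
        rwa [this]
    · refine Or.inr (Or.inr ?_)
      cases h with
      | mk b t t' h =>
        refine ⟨b, t, ?_, rfl⟩
        have : (⟨P.φ b t, hYX b t t.2⟩ : Ioo (P.X b).2.left (P.X b).2.right) = t' :=
          Subtype.ext h.symm
        show _ ∈ C
        rwa [this]
  · rintro (h | ⟨b, t, ht, rfl⟩ | ⟨b, t, ht, rfl⟩)
    · exact ⟨y, h, rfl⟩
    · exact ⟨_, ht, Quot.sound (Glue.mk b _ t (by simp))⟩
    · exact ⟨_, ht, (Quot.sound (Glue.mk b t _ rfl)).symm⟩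

theorem isProperMap_proj : IsProperMap P.proj :=
  isProperMap_iff_isClosedMap_and_compact_fibers.2
    ⟨P.continuous_proj, isClosedMap_proj, fun z => (finite_fiber z).isCompact⟩

theorem isClosedMap_ξ (a : A) : IsClosedMap (P.ξ a) :=
  isClosedMap_proj.comp IsClosedEmbedding.sigmaMk.isClosedMap

/-- The image of the open strip with index `a`. -/
def inner (P : StrippedSurface A B) (a : A) : Set P.Z := P.ξ a '' (P.S a).inner

theorem ξ_mem_inner {a b : A} {p : (P.S a).Pt} :
    P.ξ a p ∈ P.inner b ↔ a = b ∧ p ∈ (P.S a).inner := by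
  constructor
  · rintro ⟨q, hq, h⟩
    have h1 := eq_of_ξ_eq hq h.symm
    obtain rfl : a = b := congrArg Sigma.fst h1
    obtain rfl := eq_of_ξ_eq' hq h.symm
    exact ⟨rfl, hq⟩
  · rintro ⟨rfl, hp⟩
    exact ⟨p, hp, rfl⟩

theorem isOpen_ξ_image {a : A} {U : Set (P.S a).Pt} (hU : IsOpen U)
    (h : ∀ b q p, p ∈ U → P.ξ b q = P.ξ a p → ∃ p' ∈ U, (⟨b, q⟩ : P.Total) = ⟨a, p'⟩) :
    IsOpen (P.ξ a '' U) := by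
  rw [← P.isQuotientMap_proj.isOpen_preimage]
  convert isOpenMap_sigmaMk (σ := fun a => (P.S a).Pt) U hU using 1
  ext ⟨b, q⟩
  constructor
  · rintro ⟨p, hp, hpq⟩
    obtain ⟨p', hp', e⟩ := h b q p hp hpq.symm
    exact ⟨p', hp', e.symm⟩
  · rintro ⟨p, hp, hpq⟩
    exact ⟨p, hp, congrArg P.proj hpq⟩

theorem isOpen_ξ_image_of_subset {a : A} {U : Set (P.S a).Pt} (hU : IsOpen U)
    (h : U ⊆ (P.S a).inner) : IsOpen (P.ξ a '' U) :=
  isOpen_ξ_image hU fun _ _ p hp hpq => ⟨p, hp, eq_of_ξ_eq (h hp) hpq⟩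

theorem isOpen_inner (a : A) : IsOpen (P.inner a) :=
  isOpen_ξ_image_of_subset ModelStrip.isOpen_inner subset_rfl

theorem mem_inner_or_bdLeaf (z : P.Z) : (∃ a, z ∈ P.inner a) ∨ ∃ I, z ∈ P.bdLeaf I := by
  obtain ⟨a, p, rfl⟩ := P.exists_ξ_eq z
  by_cases hp : p ∈ (P.S a).inner
  · exact Or.inl ⟨a, p, hp, rfl⟩
  · obtain ⟨I, hI⟩ := ModelStrip.exists_interval_of_notMem hp
    exact Or.inr ⟨⟨a, I⟩, p, hI, rfl⟩

theorem notMem_bdLeaf {z : P.Z} {a : A} (hz : z ∈ P.inner a) (I : Σ a, (P.S a).Interval) :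
    z ∉ P.bdLeaf I := by
  rintro ⟨p, hp, rfl⟩
  exact I.2.notMem_inner hp (ξ_mem_inner.1 hz).2

/-- A point of an open strip is alone in its fibre and the chart is closed, so convergence to that
point can be tested in the surface. -/
theorem comap_ξ_nhds {a : A} {p : (P.S a).Pt} (hp : p ∈ (P.S a).inner) :
    Filter.comap (P.ξ a) (𝓝 (P.ξ a p)) = 𝓝 p := by
  rw [(isClosedMap_ξ a).comap_nhds_eq (P.continuous_ξ a)]
  have : P.ξ a ⁻¹' {P.ξ a p} = {p} := by
    ext q
    exact ⟨fun h => eq_of_ξ_eq' hp h, fun h => congrArg _ h⟩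
  rw [this, nhdsSet_singleton]

theorem tendsto_of_tendsto_ξ {ι : Type*} {l : Filter ι} {a : A} {f : ι → (P.S a).Pt}
    {p : (P.S a).Pt} (hp : p ∈ (P.S a).inner)
    (h : Filter.Tendsto (fun i => P.ξ a (f i)) l (𝓝 (P.ξ a p))) : Filter.Tendsto f l (𝓝 p) := by
  rw [← comap_ξ_nhds hp, Filter.tendsto_comap_iff]
  exact h

end StrippedSurface

/-! ### Regular points of the foliation -/

namespace StrippedSurface

variable {A : Type u} {B : Type v} {P : StrippedSurface A B}

/-- Two points lie on a common leaf. -/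
def SameLeaf (z w : P.Z) : Prop := ∃ ω, P.IsLeaf ω ∧ z ∈ ω ∧ w ∈ ω

theorem SameLeaf.symm {z w : P.Z} (h : SameLeaf z w) : SameLeaf w z := by
  obtain ⟨ω, hω, hz, hw⟩ := h
  exact ⟨ω, hω, hw, hz⟩

theorem sameLeaf_iff_mem {ω : Set P.Z} (hω : P.IsLeaf ω) {z w : P.Z} (hz : z ∈ ω) :
    SameLeaf z w ↔ w ∈ ω := by
  constructor
  · rintro ⟨η, hη, h1, h2⟩
    rwa [hω.eq_of_mem hη hz h1]
  · exact fun h => ⟨ω, hω, hz, h⟩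

theorem sameLeaf_ξ {a : A} {p : (P.S a).Pt} (hp : p ∈ (P.S a).inner) {w : P.Z} :
    SameLeaf (P.ξ a p) w ↔ ∃ q : (P.S a).Pt, q.1.2 = p.1.2 ∧ P.ξ a q = w :=
  sameLeaf_iff_mem ⟨a, _, ModelStrip.isLeaf_line hp, rfl⟩ ⟨p, rfl, rfl⟩

/-- A set is saturated if it is a union of leaves. -/
def Saturated (U : Set P.Z) : Prop := ∀ z w, SameLeaf z w → z ∈ U → w ∈ U

/-- A point of the surface is regular if its leaf can be separated by saturated open sets from each
other leaf and cuts all its sufficiently small saturated open neighbourhoods. This is an invariant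
of leaf-preserving homeomorphisms, and in a reduced surface it singles out the points of the open
strips. -/
def Regular (z : P.Z) : Prop :=
  (∀ w, ¬ SameLeaf z w → ∃ U V : Set P.Z, IsOpen U ∧ IsOpen V ∧ Saturated U ∧ Saturated V ∧
    z ∈ U ∧ w ∈ V ∧ Disjoint U V) ∧
  ∃ U : Set P.Z, IsOpen U ∧ Saturated U ∧ z ∈ U ∧ ∀ V ⊆ U, IsOpen V → Saturated V → z ∈ V →
    ¬ IsPreconnected (V \ {w | SameLeaf z w})

theorem sameLeaf_apply (h : P.homeoGroup) {z w : P.Z} :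
    SameLeaf (h.1 z) (h.1 w) ↔ SameLeaf z w := by
  have key : ∀ (h : P.homeoGroup) {z w : P.Z}, SameLeaf z w → SameLeaf (h.1 z) (h.1 w) := by
    rintro h z w ⟨ω, hω, hz, hw⟩
    exact ⟨_, h.2 ω hω, mem_image_of_mem _ hz, mem_image_of_mem _ hw⟩
  refine ⟨fun H => ?_, key h⟩
  have h2 := key h⁻¹ H
  have e : ∀ x, (h⁻¹ : P.homeoGroup).1 (h.1 x) = x := fun x => h.1.symm_apply_apply x
  rwa [e, e] at h2

theorem Saturated.preimage (h : P.homeoGroup) {U : Set P.Z} (hU : Saturated U) :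
    Saturated (h.1 ⁻¹' U) := fun _ _ hzw hz => hU _ _ ((sameLeaf_apply h).2 hzw) hz

theorem Regular.of_apply (h : P.homeoGroup) {z : P.Z} (hz : Regular (h.1 z)) : Regular z := by
  obtain ⟨h1, U, hU, hUs, hzU, h2⟩ := hz
  refine ⟨fun w hw => ?_, h.1 ⁻¹' U, hU.preimage h.1.continuous, hUs.preimage h, hzU,
    fun V hVU hV hVs hzV hconn => ?_⟩
  · obtain ⟨U, V, hU, hV, hUs, hVs, hzU, hwV, hd⟩ := h1 (h.1 w) (by rwa [sameLeaf_apply h])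
    exact ⟨h.1 ⁻¹' U, h.1 ⁻¹' V, hU.preimage h.1.continuous, hV.preimage h.1.continuous,
      hUs.preimage h, hVs.preimage h, hzU, hwV, hd.preimage _⟩
  · have e : ∀ W : Set P.Z, (h⁻¹ : P.homeoGroup).1 ⁻¹' W = h.1 '' W := fun W =>
      (h.1.toEquiv.image_eq_preimage_symm W).symm
    have hVs' : Saturated (h.1 '' V) := by
      rw [← e]
      exact hVs.preimage h⁻¹
    refine h2 (h.1 '' V) (image_subset_iff.2 hVU) (h.1.isOpenMap V hV) hVs'
      (mem_image_of_mem _ hzV) ?_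
    convert hconn.image h.1 h.1.continuous.continuousOn using 1
    ext y
    obtain ⟨x, rfl⟩ := h.1.surjective y
    simp only [mem_sdiff, h.1.injective.mem_set_image, mem_ofPred_eq, sameLeaf_apply h]

theorem regular_apply (h : P.homeoGroup) {z : P.Z} : Regular (h.1 z) ↔ Regular z := by
  refine ⟨Regular.of_apply h, fun hz => Regular.of_apply h⁻¹ ?_⟩
  have e : (h⁻¹ : P.homeoGroup).1 (h.1 z) = z := h.1.symm_apply_apply z
  rwa [e]

/-- The image of the part of a strip above a set of levels inside `(-1, 1)`. -/
def levels (P : StrippedSurface A B) (a : A) (C : Set ℝ) : Set P.Z := P.ξ a '' {p | p.1.2 ∈ C}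

theorem saturated_levels {a : A} {C : Set ℝ} (hC : C ⊆ Ioo (-1) 1) :
    Saturated (P.levels a C) := by
  rintro _ w hzw ⟨p, hp, rfl⟩
  obtain ⟨q, hq, rfl⟩ := (sameLeaf_ξ (hC hp)).1 hzw
  exact ⟨q, show q.1.2 ∈ C from hq ▸ hp, rfl⟩

theorem Saturated.compl {U : Set P.Z} (hU : Saturated U) : Saturated Uᶜ :=
  fun z w h hz hw => hz (hU w z h.symm hw)

theorem isOpen_levels {a : A} {c d : ℝ} (hc : -1 ≤ c) (hd : d ≤ 1) :
    IsOpen (P.levels a (Ioo c d)) :=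
  isOpen_ξ_image_of_subset (isOpen_Ioo.preimage (by fun_prop))
    fun _ hp => ⟨hc.trans_lt hp.1, hp.2.trans_le hd⟩

theorem isClosed_levels (a : A) (c d : ℝ) : IsClosed (P.levels a (Icc c d)) :=
  isClosedMap_ξ a _ (isClosed_Icc.preimage (by fun_prop))

theorem levels_mono {a : A} {C D : Set ℝ} (h : C ⊆ D) : P.levels a C ⊆ P.levels a D :=
  image_mono fun _ hp => h hp

theorem ξ_mem_levels {a : A} {p : (P.S a).Pt} {C : Set ℝ} (hp : p ∈ (P.S a).inner) :
    P.ξ a p ∈ P.levels a C ↔ p.1.2 ∈ C := by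
  constructor
  · rintro ⟨q, hq, h⟩
    rwa [← eq_of_ξ_eq' hp h]
  · exact fun h => ⟨p, h, rfl⟩

theorem regular_of_mem_inner {z : P.Z} {a : A} (hz : z ∈ P.inner a) : Regular z := by
  obtain ⟨p, hp, rfl⟩ := hz
  have hp1 : -1 < p.1.2 := hp.1
  have hp2 : p.1.2 < 1 := hp.2
  refine ⟨fun w hw => ?_, P.levels a (Ioo (-1) 1), isOpen_levels le_rfl le_rfl,
    saturated_levels subset_rfl, ⟨p, hp, rfl⟩, fun V hV hVo hVs hpV hconn => ?_⟩
  · -- a band of levels around that of `p` avoiding `w`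
    obtain ⟨ε, hε, h1, h2, h3⟩ : ∃ ε > 0, -1 < p.1.2 - ε ∧ p.1.2 + ε < 1 ∧
        w ∉ P.levels a (Icc (p.1.2 - ε) (p.1.2 + ε)) := by
      by_cases hwa : w ∈ P.inner a
      · obtain ⟨q, hq, rfl⟩ := hwa
        have hne : q.1.2 - p.1.2 ≠ 0 := fun h =>
          hw ((sameLeaf_ξ hp).2 ⟨q, by linarith, rfl⟩)
        have hpos := abs_pos.2 hne
        refine ⟨min (|q.1.2 - p.1.2| / 2) (min ((1 + p.1.2) / 2) ((1 - p.1.2) / 2)),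
          lt_min (by linarith) (lt_min (by linarith) (by linarith)), ?_, ?_, ?_⟩
        · have := (min_le_right (|q.1.2 - p.1.2| / 2) _).trans
            (min_le_left ((1 + p.1.2) / 2) ((1 - p.1.2) / 2))
          linarith
        · have := (min_le_right (|q.1.2 - p.1.2| / 2) _).trans
            (min_le_right ((1 + p.1.2) / 2) ((1 - p.1.2) / 2))
          linarith
        · rw [ξ_mem_levels hq]
          rintro ⟨h1, h2⟩
          have h3 := min_le_left (|q.1.2 - p.1.2| / 2) (min ((1 + p.1.2) / 2) ((1 - p.1.2) / 2))
          have h4 : |q.1.2 - p.1.2| ≤ |q.1.2 - p.1.2| / 2 :=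
            abs_le.2 ⟨by linarith, by linarith⟩
          linarith
      · refine ⟨min ((1 + p.1.2) / 2) ((1 - p.1.2) / 2),
          lt_min (by linarith) (by linarith), ?_, ?_, ?_⟩
        · linarith [min_le_left ((1 + p.1.2) / 2) ((1 - p.1.2) / 2)]
        · linarith [min_le_right ((1 + p.1.2) / 2) ((1 - p.1.2) / 2)]
        · refine fun h => hwa (levels_mono (fun y hy => ?_) h)
          exact ⟨by linarith [hy.1, min_le_left ((1 + p.1.2) / 2) ((1 - p.1.2) / 2)],
            by linarith [hy.2, min_le_right ((1 + p.1.2) / 2) ((1 - p.1.2) / 2)]⟩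
    have hsub : Icc (p.1.2 - ε) (p.1.2 + ε) ⊆ Ioo (-1 : ℝ) 1 := fun y hy =>
      ⟨h1.trans_le hy.1, hy.2.trans_lt h2⟩
    refine ⟨P.levels a (Ioo (p.1.2 - ε) (p.1.2 + ε)), (P.levels a (Icc (p.1.2 - ε) (p.1.2 + ε)))ᶜ,
      isOpen_levels h1.le h2.le, (isClosed_levels a _ _).isOpen_compl,
      saturated_levels (Ioo_subset_Icc_self.trans hsub), (saturated_levels hsub).compl,
      ⟨p, ⟨by linarith, by linarith⟩, rfl⟩, h3, ?_⟩
    exact disjoint_compl_right.mono_left (levels_mono Ioo_subset_Icc_self)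
  · -- the levels below and above that of `p` disconnect `V`
    have hVa : IsOpen (P.ξ a ⁻¹' V) := hVo.preimage (P.continuous_ξ a)
    obtain ⟨ε, hε, hbox⟩ := ModelStrip.mem_nhds_iff.1 (hVa.mem_nhds hpV)
    have hlow : (V \ {w | SameLeaf (P.ξ a p) w} ∩ P.levels a (Ioo (-1) p.1.2)).Nonempty := by
      obtain ⟨y, hy1, hy2⟩ := exists_between (max_lt hp1 (sub_lt_self p.1.2 hε))
      have hy3 := (le_max_left _ _).trans_lt hy1
      have hy4 := (le_max_right _ _).trans_lt hy1
      obtain ⟨h, hm⟩ := hbox p.1.1 y (by simpa using hε) (abs_lt.2 ⟨by linarith, by linarith⟩)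
        ⟨by linarith, by linarith⟩
      refine ⟨_, ⟨hm, fun hs => ?_⟩, ⟨_, ⟨hy3, hy2⟩, rfl⟩⟩
      obtain ⟨q, hq, hqe⟩ := (sameLeaf_ξ hp).1 hs
      have := eq_of_ξ_eq' (p := ⟨(p.1.1, y), h⟩) ⟨hy3, hy2.trans hp2⟩ hqe
      rw [this] at hq
      exact hy2.ne hq
    have hupp : (V \ {w | SameLeaf (P.ξ a p) w} ∩ P.levels a (Ioo p.1.2 1)).Nonempty := by
      obtain ⟨y, hy1, hy2⟩ := exists_between (lt_min hp2 (lt_add_of_pos_right p.1.2 hε))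
      have hy3 := hy2.trans_le (min_le_left _ _)
      have hy4 := hy2.trans_le (min_le_right _ _)
      obtain ⟨h, hm⟩ := hbox p.1.1 y (by simpa using hε) (abs_lt.2 ⟨by linarith, by linarith⟩)
        ⟨by linarith, by linarith⟩
      refine ⟨_, ⟨hm, fun hs => ?_⟩, ⟨_, ⟨hy1, hy3⟩, rfl⟩⟩
      obtain ⟨q, hq, hqe⟩ := (sameLeaf_ξ hp).1 hs
      have := eq_of_ξ_eq' (p := ⟨(p.1.1, y), h⟩) ⟨hp1.trans hy1, hy3⟩ hqe
      rw [this] at hq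
      exact hy1.ne' hq
    have hcover : V \ {w | SameLeaf (P.ξ a p) w} ⊆
        P.levels a (Ioo (-1) p.1.2) ∪ P.levels a (Ioo p.1.2 1) := by
      intro w hw
      obtain ⟨q, hq, rfl⟩ := hV hw.1
      rcases lt_trichotomy q.1.2 p.1.2 with h | h | h
      · exact Or.inl ⟨q, ⟨hq.1, h⟩, rfl⟩
      · exact absurd ((sameLeaf_ξ hp).2 ⟨q, h, rfl⟩) hw.2
      · exact Or.inr ⟨q, ⟨h, hq.2⟩, rfl⟩
    obtain ⟨w, -, ⟨q, hq, rfl⟩, hw2⟩ := hconn _ _ (isOpen_levels le_rfl hp2.le)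
      (isOpen_levels hp1.le le_rfl) hcover hlow hupp
    rw [ξ_mem_levels ⟨hq.1, hq.2.trans hp2⟩] at hw2
    exact lt_asymm hq.2 hw2.1

/-- The levels of the open strip at distance less than `ε` from one of the two sides. -/
def nearSide (s : Bool) (ε : ℝ) : Set ℝ := Ioo (-1) 1 ∩ Ioo (stripLevel s - ε) (stripLevel s + ε)

theorem nearSide_eq (s : Bool) (ε : ℝ) : nearSide s ε =
    Ioo (max (-1) (stripLevel s - ε)) (min 1 (stripLevel s + ε)) := Ioo_inter_Ioo

theorem nonempty_nearSide (s : Bool) {ε : ℝ} (hε : 0 < ε) : (nearSide s ε).Nonempty := by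
  rw [nearSide_eq, nonempty_Ioo]
  cases s <;> simp [stripLevel] <;> grind

/-- A saturated open set that meets a side of a strip contains all interior lines near it. -/
theorem exists_nearSide_subset {U : Set P.Z} (hU : IsOpen U) (hUs : Saturated U) {a : A}
    {p : (P.S a).Pt} {s : Bool} (hp : p.1.2 = stripLevel s) (hpU : P.ξ a p ∈ U) :
    ∃ ε > 0, P.levels a (nearSide s ε) ⊆ U := by
  obtain ⟨ε, hε, hbox⟩ := ModelStrip.mem_nhds_iff.1 ((hU.preimage (P.continuous_ξ a)).mem_nhds hpU)
  refine ⟨ε, hε, ?_⟩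
  rintro _ ⟨q, ⟨hq, hq'⟩, rfl⟩
  obtain ⟨h, hm⟩ := hbox p.1.1 q.1.2 (by simpa using hε)
    (by rw [hp]; exact abs_lt.2 ⟨by linarith [hq'.1], by linarith [hq'.2]⟩) (ModelStrip.mem_Icc q)
  exact hUs _ _ ((sameLeaf_ξ (p := ⟨(p.1.1, q.1.2), h⟩) hq).2 ⟨q, rfl, rfl⟩) hm

/-- A leaf is not regular if it is seen from one side of one strip only: it does not cut its small
saturated neighbourhoods. -/
theorem not_regular_of_one_side {I : Σ a, (P.S a).Interval} {a : A} {s : Bool}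
    (hI : ∀ x : P.Total, P.proj x ∈ P.bdLeaf I →
      ∃ p : (P.S a).Pt, x = ⟨a, p⟩ ∧ p.1.2 = stripLevel s)
    {z : P.Z} (hz : z ∈ P.bdLeaf I) : ¬ Regular z := by
  rintro ⟨-, U, hU, hUs, hzU, h⟩
  obtain ⟨x, rfl⟩ := P.proj_surjective z
  obtain ⟨p, rfl, hp⟩ := hI x hz
  obtain ⟨ε, hε, hsub⟩ := exists_nearSide_subset hU hUs hp hzU
  have hleaf : {w | SameLeaf (P.ξ a p) w} = P.bdLeaf I := by
    ext w
    exact sameLeaf_iff_mem (isLeaf_bdLeaf I) hz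
  set E : Set (P.S a).Pt := P.ξ a ⁻¹' P.bdLeaf I
  have hE : P.ξ a '' E = P.bdLeaf I := by
    refine image_preimage_eq_of_subset fun w hw => ?_
    obtain ⟨x, rfl⟩ := P.proj_surjective w
    obtain ⟨q, rfl, -⟩ := hI x hw
    exact ⟨q, rfl⟩
  have hNs : nearSide s ε ⊆ Ioo (-1) 1 := inter_subset_left
  have hEs : ∀ q ∈ E, q.1.2 = stripLevel s := by
    intro q hq
    obtain ⟨q', h1, h2⟩ := hI ⟨a, q⟩ hq
    rwa [eq_of_heq (Sigma.mk.inj h1).2]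
  have hV : P.ξ a '' ({q | q.1.2 ∈ nearSide s ε} ∪ E) = P.levels a (nearSide s ε) ∪ P.bdLeaf I := by
    rw [image_union, hE]
    rfl
  have hdisj : Disjoint (P.levels a (nearSide s ε)) (P.bdLeaf I) := by
    rw [disjoint_left]
    rintro _ ⟨q, hq, rfl⟩
    exact notMem_bdLeaf ⟨q, hNs hq, rfl⟩ I
  refine h (P.levels a (nearSide s ε) ∪ P.bdLeaf I) ?_ ?_ ?_ (Or.inr hz) ?_
  · refine union_subset hsub fun w hw => hUs _ _ ?_ hzU
    exact (sameLeaf_iff_mem (isLeaf_bdLeaf I) hz).2 hw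
  · rw [← hV]
    refine isOpen_ξ_image ?_ ?_
    · rw [isOpen_iff_mem_nhds]
      rintro q (hq | hq)
      · exact Filter.mem_of_superset
          (((isOpen_Ioo.inter isOpen_Ioo).preimage (by fun_prop)).mem_nhds hq) subset_union_left
      · obtain ⟨J, -, hJ⟩ := ModelStrip.exists_interval (hEs q hq)
        have h1 : ∀ᶠ r : (P.S a).Pt in 𝓝 q, r.1.2 ∈ Ioo (stripLevel s - ε) (stripLevel s + ε) :=
          (isOpen_Ioo.preimage (by fun_prop)).mem_nhds
            (by
              show q.1.2 ∈ Ioo (stripLevel s - ε) (stripLevel s + ε)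
              rw [hEs q hq]
              exact ⟨by linarith, by linarith⟩)
        filter_upwards [h1, ModelStrip.Interval.inner_union_mem_nhds hJ] with r hr1 hr2
        rcases hr2 with hr2 | hr2
        · exact Or.inl ⟨hr2, hr1⟩
        · right
          have : P.bdLeaf ⟨a, J⟩ = P.bdLeaf I :=
            (isLeaf_bdLeaf _).eq_of_mem (isLeaf_bdLeaf I) (z := P.ξ a q) ⟨q, hJ, rfl⟩ hq
          show P.ξ a r ∈ P.bdLeaf I
          rw [← this]
          exact ⟨r, hr2, rfl⟩
    · rintro b r q (hq | hq) hrq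
      · exact ⟨q, Or.inl hq, eq_of_ξ_eq (hNs hq) hrq⟩
      · have hr : P.proj ⟨b, r⟩ ∈ P.bdLeaf I := by
          rw [proj_mk, hrq]
          exact hq
        obtain ⟨r', h1, -⟩ := hI _ hr
        refine ⟨r', Or.inr ?_, h1⟩
        rw [h1] at hr
        exact hr
  · rintro w w' hw (h1 | h1)
    · exact Or.inl (saturated_levels hNs _ _ hw h1)
    · exact Or.inr ((sameLeaf_iff_mem (isLeaf_bdLeaf I) h1).1 hw)
  · rw [proj_mk, hleaf, union_sdiff_right, hdisj.sdiff_eq_left]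
    refine IsPreconnected.image ?_ _ (P.continuous_ξ a).continuousOn
    rw [nearSide_eq]
    exact ModelStrip.isPreconnected_levels (le_max_left _ _) (min_le_left _ _)

/-- In a reduced surface, the points of boundary leaves and of glued leaves are not regular. -/
theorem not_regular_of_mem_bdLeaf (hred : P.IsReduced) {I : Σ a, (P.S a).Interval} {z : P.Z}
    (hz : z ∈ P.bdLeaf I) : ¬ Regular z := by
  by_cases hA : ∃ (a : A) (s : Bool), ∀ x : P.Total, P.proj x ∈ P.bdLeaf I →
      ∃ p : (P.S a).Pt, x = ⟨a, p⟩ ∧ p.1.2 = stripLevel s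
  · obtain ⟨a, s, hI⟩ := hA
    exact not_regular_of_one_side hI hz
  · -- the leaf is seen from two different sides, one of which contains a second boundary interval
    have hpts : ∀ (J : Σ a, (P.S a).Interval), ∀ x ∈ P.pts J,
        ∃ p : (P.S J.1).Pt, x = ⟨J.1, p⟩ ∧ p.1.2 = stripLevel J.2.side := by
      rintro J _ ⟨p, hp, rfl⟩
      exact ⟨p, rfl, hp.1⟩
    have hglued : ∃ J, Glued I J := by
      by_contra hno
      refine hA ⟨I.1, I.2.side, fun x hx => ?_⟩
      rcases mem_bdLeaf hx with h | ⟨J, hJ, -⟩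
      · exact hpts I x h
      · exact absurd ⟨J, hJ⟩ hno
    have hspec : ∃ I' J', Glued I' J' ∧ P.bdLeaf I' = P.bdLeaf I ∧ ¬ P.IsWholeSide I' := by
      obtain ⟨J, b, hb⟩ := hglued
      have hX : P.bdLeaf I = P.bdLeaf (P.X b) := by
        rcases hb with ⟨rfl, -⟩ | ⟨rfl, -⟩
        · exact P.bdLeaf_eq b
        · rfl
      obtain ⟨b', h1 | h1, h2⟩ := hred b
      · exact ⟨_, _, ⟨b', Or.inr ⟨rfl, rfl⟩⟩, (hX.trans h2).symm, h1⟩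
      · exact ⟨_, _, ⟨b', Or.inl ⟨rfl, rfl⟩⟩, (P.bdLeaf_eq b').trans (hX.trans h2).symm, h1⟩
    obtain ⟨I', J', hIJ, hleaf, hwhole⟩ := hspec
    rw [← hleaf] at hz hA
    obtain ⟨p', hp', hp'I⟩ : ∃ p' ∈ (P.S I'.1).bd I'.2.side, p' ∉ I'.2.toSet := by
      by_contra! hno
      exact hwhole (Subset.antisymm (fun p hp => hp.1) hno)
    have hw : P.ξ I'.1 p' ∉ P.bdLeaf I' := by
      intro hmem
      refine hA ⟨I'.1, I'.2.side, fun x hx => ?_⟩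
      rcases mem_bdLeaf (x := ⟨I'.1, p'⟩) hmem with ⟨q, hq, hqe⟩ | ⟨J, hJ, q, hq, hqe⟩
      · rw [eq_of_heq (Sigma.mk.inj hqe).2] at hq
        exact absurd hq hp'I
      · rcases mem_bdLeaf hx with h | ⟨J2, hJ2, h⟩
        · exact hpts I' x h
        · obtain rfl := hJ.unique hJ2
          obtain ⟨y, rfl, hy⟩ := hpts J x h
          obtain ⟨a', J⟩ := J
          obtain ⟨a, I'⟩ := I'
          obtain rfl : a' = a := congrArg Sigma.fst hqe
          have hqp : q = p' := eq_of_heq (Sigma.mk.inj hqe).2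
          refine ⟨y, rfl, ?_⟩
          rw [hy, ← hq.1, hqp]
          exact hp'
    rintro ⟨hsep, -⟩
    obtain ⟨U, V, hU, hV, hUs, hVs, hzU, hwV, hd⟩ := hsep (P.ξ I'.1 p')
      fun h => hw ((sameLeaf_iff_mem (isLeaf_bdLeaf I') hz).1 h)
    obtain ⟨p, hp, rfl⟩ := hz
    obtain ⟨ε, hε, h1⟩ := exists_nearSide_subset hU hUs hp.1 hzU
    obtain ⟨δ, hδ, h2⟩ := exists_nearSide_subset hV hVs hp' hwV
    obtain ⟨y, hy, hy'⟩ := nonempty_nearSide I'.2.side (lt_min hε hδ)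
    have hm : ∀ η, min ε δ ≤ η → P.ξ I'.1 ⟨(0, y), Or.inl hy⟩ ∈
        P.levels I'.1 (nearSide I'.2.side η) := fun η hη =>
      ⟨_, ⟨hy, by show _ < y; linarith [hy'.1], by show y < _; linarith [hy'.2]⟩, rfl⟩
    exact disjoint_left.1 hd (h1 (hm ε (min_le_left _ _))) (h2 (hm δ (min_le_right _ _)))

/-- In a reduced surface, leaf-preserving homeomorphisms preserve the union of the open strips. -/
theorem exists_mem_inner_apply (hred : P.IsReduced) (h : P.homeoGroup) {z : P.Z} :
    (∃ a, h.1 z ∈ P.inner a) ↔ ∃ a, z ∈ P.inner a := by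
  have key : ∀ w : P.Z, (∃ a, w ∈ P.inner a) ↔ Regular w := fun w => by
    refine ⟨fun ⟨a, ha⟩ => regular_of_mem_inner ha, fun hw => ?_⟩
    rcases mem_inner_or_bdLeaf w with h | ⟨I, hI⟩
    · exact h
    · exact absurd hw (not_regular_of_mem_bdLeaf hred hI)
  rw [key, key, regular_apply]

end StrippedSurface

/-! ### Lifting through closed maps with finite fibres -/

/-- A partial lift, defined on a dense set `D`, of a continuous map `k` through a closed map `q`
with finite fibres extends to a continuous lift, provided that `D` does not locally disconnect the
space: near a point the partial lift takes values in the union of disjoint small neighbourhoods of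
the finitely many points of a fibre, hence, by connectedness, in one of them. -/
theorem exists_continuous_lift {X Z : Type*} [TopologicalSpace X] [T3Space X] [TopologicalSpace Z]
    {q : X → Z} (hcl : IsClosedMap q) (hfin : ∀ z, (q ⁻¹' {z}).Finite)
    {D : Set X} (hD : Dense D)
    (hconn : ∀ x, ∀ N ∈ 𝓝 x, ∃ H ∈ 𝓝 x, H ⊆ N ∧ IsPreconnected (H ∩ D))
    {k : X → Z} (hk : Continuous k) {g₀ : X → X} (hg₀ : ContinuousOn g₀ D)
    (hqg : ∀ x ∈ D, q (g₀ x) = k x) :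
    ∃ g : X → X, Continuous g ∧ (∀ x ∈ D, g x = g₀ x) ∧ ∀ x, q (g x) = k x := by
  have key : ∀ x, ∃ y, q y = k x ∧ Filter.Tendsto g₀ (𝓝[D] x) (𝓝 y) := by
    intro x
    obtain ⟨U, hU, hdisj⟩ := (hfin (k x)).t2_separation
    have hev : ∀ᶠ z in 𝓝 (k x), ∀ y ∈ q ⁻¹' {z}, y ∈ ⋃ w ∈ q ⁻¹' {k x}, U w :=
      hcl.eventually_nhds_fiber _ fun w hw => Filter.mem_of_superset
        ((hU w).2.mem_nhds (hU w).1) (subset_biUnion_of_mem hw)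
    obtain ⟨H, hHx, hHN, hH⟩ := hconn x _ (hk.continuousAt.eventually hev)
    have hmem : ∀ x' ∈ H ∩ D, ∃ w ∈ q ⁻¹' {k x}, g₀ x' ∈ U w := fun x' hx' => by
      simpa using hHN hx'.1 (g₀ x') (hqg x' hx'.2)
    obtain ⟨d, hd⟩ : (H ∩ D).Nonempty := by
      rw [inter_comm]
      exact hD.inter_nhds_nonempty hHx
    obtain ⟨y, hy, hdy⟩ := hmem d hd
    set V : Set X := ⋃ w ∈ q ⁻¹' {k x} \ {y}, U w with hV
    have hVo : IsOpen V := isOpen_biUnion fun w _ => (hU w).2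
    have hUV : Disjoint (U y) V := by
      rw [hV, disjoint_iUnion₂_right]
      exact fun w hw => hdisj hy hw.1 (Ne.symm hw.2)
    have hsub : g₀ '' (H ∩ D) ⊆ U y := by
      refine (hH.image g₀ (hg₀.mono inter_subset_right)).subset_left_of_subset_union
        (hU y).2 hVo hUV ?_ ⟨_, ⟨d, hd, rfl⟩, hdy⟩
      rintro _ ⟨x', hx', rfl⟩
      obtain ⟨w, hw, hxw⟩ := hmem x' hx'
      by_cases hwy : w = y
      · exact Or.inl (hwy ▸ hxw)
      · exact Or.inr (mem_biUnion (show w ∈ q ⁻¹' {k x} \ {y} from ⟨hw, hwy⟩) hxw)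
    refine ⟨y, hy, fun N hN => ?_⟩
    have hev2 : ∀ᶠ z in 𝓝 (k x), ∀ y' ∈ q ⁻¹' {z}, y' ∈ N ∪ V := by
      refine hcl.eventually_nhds_fiber _ fun w hw => ?_
      by_cases hwy : w = y
      · exact Filter.mem_of_superset (hwy ▸ hN) subset_union_left
      · exact Filter.mem_of_superset (hVo.mem_nhds
          (mem_biUnion (show w ∈ q ⁻¹' {k x} \ {y} from ⟨hw, hwy⟩) (hU w).1)) subset_union_right
    rw [Filter.mem_map]
    filter_upwards [nhdsWithin_le_nhds hHx, self_mem_nhdsWithin,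
      nhdsWithin_le_nhds (hk.continuousAt.eventually hev2)] with x' h1 h2 h3
    rcases h3 (g₀ x') (hqg x' h2) with h4 | h4
    · exact h4
    · exact absurd h4 (disjoint_left.1 hUV (hsub ⟨x', ⟨h1, h2⟩, rfl⟩))
  refine ⟨extendFrom D g₀, continuous_extendFrom hD fun x => (key x).imp fun _ h => h.2, ?_, ?_⟩
  · exact fun x hx => extendFrom_eq (hD x) (hg₀ x hx)
  · intro x
    obtain ⟨y, h1, h2⟩ := key x
    rw [extendFrom_eq (hD x) h2, h1]

/-- A family `f t` of continuous maps is jointly continuous if its composition with a closed map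
`q` with finite fibres is, provided that the values `f t x` at each point `x` stay in a closed set
that meets each fibre involved in a single point. -/
theorem continuous_uncurry_of_lift {T X Y Z : Type*} [TopologicalSpace T] [TopologicalSpace X]
    [TopologicalSpace Y] [T2Space Y] [TopologicalSpace Z] {q : Y → Z}
    (hcl : IsClosedMap q) (hfin : ∀ z, (q ⁻¹' {z}).Finite)
    (hconn : ∀ x : X, ∀ N ∈ 𝓝 x, ∃ H ∈ 𝓝 x, H ⊆ N ∧ IsPreconnected H)
    {f : T → X → Y} (hqf : Continuous fun i : T × X => q (f i.1 i.2)) (hf : ∀ t, Continuous (f t))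
    (hC : ∀ x, ∃ C : Set Y, IsClosed C ∧ ∀ t, f t x ∈ C ∧ ∀ y ∈ C, q y = q (f t x) → y = f t x) :
    Continuous fun i : T × X => f i.1 i.2 := by
  rw [continuous_iff_continuousAt]
  rintro ⟨t₀, x₀⟩ N hN
  change N ∈ 𝓝 (f t₀ x₀) at hN
  obtain ⟨C, hCc, hC⟩ := hC x₀
  obtain ⟨U, hU, hdisj⟩ := (hfin (q (f t₀ x₀))).t2_separation
  set D₁ : Set Y := interior N ∩ U (f t₀ x₀) with hD₁
  set D₂ : Set Y := ⋃ w ∈ q ⁻¹' {q (f t₀ x₀)} \ {f t₀ x₀}, U w ∩ Cᶜ with hD₂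
  have hD₁o : IsOpen D₁ := isOpen_interior.inter (hU _).2
  have hD₂o : IsOpen D₂ := isOpen_biUnion fun w _ => (hU w).2.inter hCc.isOpen_compl
  have hD₁₂ : Disjoint D₁ D₂ := by
    rw [hD₂, disjoint_iUnion₂_right]
    intro w hw
    exact (hdisj (show f t₀ x₀ ∈ q ⁻¹' {q (f t₀ x₀)} from rfl) hw.1 (Ne.symm hw.2)).mono
      inter_subset_right inter_subset_left
  have hev : ∀ᶠ z in 𝓝 (q (f t₀ x₀)), ∀ y ∈ q ⁻¹' {z}, y ∈ D₁ ∪ D₂ := by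
    refine hcl.eventually_nhds_fiber _ fun w hw => (hD₁o.union hD₂o).mem_nhds ?_
    by_cases hwe : w = f t₀ x₀
    · exact Or.inl (hwe ▸ ⟨mem_interior_iff_mem_nhds.2 hN, (hU _).1⟩)
    · exact Or.inr (mem_biUnion (show w ∈ q ⁻¹' {q (f t₀ x₀)} \ {f t₀ x₀} from ⟨hw, hwe⟩)
        ⟨(hU w).1, fun hwC => hwe ((hC t₀).2 w hwC hw)⟩)
  have hev2 : ∀ᶠ i in 𝓝 (t₀, x₀), f i.1 i.2 ∈ D₁ ∪ D₂ := by
    filter_upwards [(hqf.tendsto (t₀, x₀)).eventually hev] with i hi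
    exact hi _ rfl
  rw [nhds_prod_eq] at hev2
  obtain ⟨V, hV, M, hM, hVM⟩ := Filter.mem_prod_iff.1 hev2
  obtain ⟨H, hH, hHM, hHc⟩ := hconn x₀ M hM
  rw [Filter.mem_map, nhds_prod_eq]
  refine Filter.mem_of_superset (Filter.prod_mem_prod hV hH) ?_
  rintro ⟨t, x⟩ ⟨ht, hx⟩
  have hsub : f t '' H ⊆ D₁ ∪ D₂ := by
    rintro _ ⟨x', hx', rfl⟩
    exact hVM (show (t, x') ∈ V ×ˢ M from ⟨ht, hHM hx'⟩)
  have hx₀ : f t x₀ ∈ f t '' H := mem_image_of_mem _ (mem_of_mem_nhds hH)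
  have hmem : f t x₀ ∈ D₁ := by
    refine (hsub hx₀).resolve_right fun h => ?_
    simp only [hD₂, mem_iUnion] at h
    obtain ⟨w, -, -, hw⟩ := h
    exact hw (hC t).1
  have := (hHc.image (f t) (hf t).continuousOn).subset_left_of_subset_union hD₁o hD₂o hD₁₂ hsub
    ⟨_, hx₀, hmem⟩
  exact interior_subset (s := N) (this (mem_image_of_mem _ hx)).1

/-! ### Lifts of homeomorphisms to the strips -/

/-- A strictly increasing bijection of `(-1, 1)` extends to a homeomorphism of `[-1, 1]`. -/
theorem exists_homeomorph_Icc_of_strictMonoOn {m : ℝ → ℝ}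
    (hm : StrictMonoOn m (Ioo (-1) 1)) (himg : m '' Ioo (-1) 1 = Ioo (-1) 1) :
    ∃ μ : Icc (-1 : ℝ) 1 ≃ₜ Icc (-1 : ℝ) 1, StrictMono μ ∧
      ∀ y : Icc (-1 : ℝ) 1, (y : ℝ) ∈ Ioo (-1 : ℝ) 1 → (μ y : ℝ) = m y := by
  classical
  have hmaps : ∀ y ∈ Ioo (-1 : ℝ) 1, m y ∈ Ioo (-1 : ℝ) 1 := fun y hy =>
    himg ▸ mem_image_of_mem m hy
  let M : Icc (-1 : ℝ) 1 → Icc (-1 : ℝ) 1 := fun y =>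
    if h : (y : ℝ) ∈ Ioo (-1 : ℝ) 1 then ⟨m y, Ioo_subset_Icc_self (hmaps y h)⟩ else y
  have hM1 : ∀ y : Icc (-1 : ℝ) 1, (y : ℝ) ∈ Ioo (-1 : ℝ) 1 → (M y : ℝ) = m y := fun y hy => by
    simp only [M, dif_pos hy]
  have hM2 : ∀ y : Icc (-1 : ℝ) 1, (y : ℝ) ∉ Ioo (-1 : ℝ) 1 → M y = y := fun y hy => by
    simp only [M, dif_neg hy]
  have hmono : StrictMono M := by
    intro y z hyz
    show (M y : ℝ) < M z
    have hyz' : (y : ℝ) < z := hyz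
    by_cases hy : (y : ℝ) ∈ Ioo (-1 : ℝ) 1 <;> by_cases hz : (z : ℝ) ∈ Ioo (-1 : ℝ) 1
    · rw [hM1 y hy, hM1 z hz]
      exact hm hy hz hyz
    · have hz1 : (1 : ℝ) ≤ z := le_of_not_gt fun h => hz ⟨hy.1.trans hyz', h⟩
      rw [hM1 y hy, hM2 z hz]
      exact (hmaps y hy).2.trans_le hz1
    · have hy1 : (y : ℝ) ≤ -1 := le_of_not_gt fun h => hy ⟨h, hyz'.trans hz.2⟩
      rw [hM1 z hz, hM2 y hy]
      exact hy1.trans_lt (hmaps z hz).1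
    · rw [hM2 y hy, hM2 z hz]
      exact hyz'
  have hsurj : Function.Surjective M := by
    intro z
    by_cases hz : (z : ℝ) ∈ Ioo (-1 : ℝ) 1
    · obtain ⟨y, hy, hyz⟩ := himg.symm ▸ hz
      exact ⟨⟨y, Ioo_subset_Icc_self hy⟩, Subtype.ext ((hM1 _ hy).trans hyz)⟩
    · exact ⟨z, hM2 z hz⟩
  exact ⟨(hmono.orderIsoOfSurjective M hsurj).toHomeomorph, hmono, hM1⟩

theorem exists_homeomorph_Icc_of_injOn {m : ℝ → ℝ} (hc : ContinuousOn m (Ioo (-1) 1))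
    (hinj : InjOn m (Ioo (-1) 1)) (himg : m '' Ioo (-1) 1 = Ioo (-1) 1) :
    ∃ μ : Icc (-1 : ℝ) 1 ≃ₜ Icc (-1 : ℝ) 1, ∀ y : Icc (-1 : ℝ) 1, (y : ℝ) ∈ Ioo (-1 : ℝ) 1 →
      (μ y : ℝ) = m y := by
  rcases hc.strictMonoOn_of_injOn_Ioo (by norm_num) hinj with hm | hm
  · obtain ⟨μ, -, hμ⟩ := exists_homeomorph_Icc_of_strictMonoOn hm himg
    exact ⟨μ, hμ⟩
  · have himg' : (fun y => -m y) '' Ioo (-1) 1 = Ioo (-1) 1 := by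
      rw [← image_image (fun y => -y) m, himg]
      simp
    obtain ⟨μ, -, hμ⟩ := exists_homeomorph_Icc_of_strictMonoOn
      (m := fun y => -m y) (fun y hy z hz hyz => neg_lt_neg (hm hy hz hyz)) himg'
    have hneg : ∀ y : Icc (-1 : ℝ) 1, -(y : ℝ) ∈ Icc (-1 : ℝ) 1 := fun y =>
      ⟨by linarith [y.2.2], by linarith [y.2.1]⟩
    let ν : Icc (-1 : ℝ) 1 ≃ₜ Icc (-1 : ℝ) 1 :=
      { toFun := fun y => ⟨-y, hneg y⟩
        invFun := fun y => ⟨-y, hneg y⟩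
        left_inv := fun y => Subtype.ext (neg_neg _)
        right_inv := fun y => Subtype.ext (neg_neg _) }
    refine ⟨μ.trans ν, fun y hy => ?_⟩
    show -(μ y : ℝ) = m y
    rw [hμ y hy, neg_neg]

namespace StrippedSurface

variable {A : Type u} {B : Type v} {P : StrippedSurface A B}

theorem mem_inner_iff {a : A} {z : P.Z} : z ∈ P.inner a ↔ z ∈ P.strip a ∧ ∃ b, z ∈ P.inner b := by
  constructor
  · rintro ⟨p, hp, rfl⟩
    exact ⟨⟨p, rfl⟩, a, p, hp, rfl⟩
  · rintro ⟨⟨p, rfl⟩, b, hb⟩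
    obtain ⟨rfl, hp⟩ := ξ_mem_inner.1 hb
    exact ⟨p, hp, rfl⟩

theorem apply_mem_strip {h : P.homeoGroup} {a : A} (hs : h.1 '' P.strip a = P.strip a) {z : P.Z} :
    h.1 z ∈ P.strip a ↔ z ∈ P.strip a := by
  conv_lhs => rw [← hs]
  exact h.1.injective.mem_set_image

theorem apply_mem_inner (hred : P.IsReduced) {h : P.homeoGroup} {a : A}
    (hs : h.1 '' P.strip a = P.strip a) {z : P.Z} : h.1 z ∈ P.inner a ↔ z ∈ P.inner a := by
  rw [mem_inner_iff, mem_inner_iff, apply_mem_strip hs, exists_mem_inner_apply hred]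

/-- A homeomorphism that preserves a strip and the corresponding open strip lifts to the strip. -/
theorem exists_lift_fun {k : P.Z → P.Z} (hk : Continuous k) {a : A}
    (hs : ∀ z ∈ P.strip a, k z ∈ P.strip a) (hi : ∀ z ∈ P.inner a, k z ∈ P.inner a) :
    ∃ g : (P.S a).Pt → (P.S a).Pt, Continuous g ∧ ∀ p, P.ξ a (g p) = k (P.ξ a p) := by
  have hex : ∀ p, ∃ r, P.ξ a r = k (P.ξ a p) := fun p => hs _ ⟨p, rfl⟩
  choose g₀ hg₀ using hex
  have hcont : ContinuousOn g₀ (P.S a).inner := by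
    intro p hp
    have hin : g₀ p ∈ (P.S a).inner := by
      have := hi _ ⟨p, hp, rfl⟩
      rw [← hg₀ p] at this
      exact (ξ_mem_inner.1 this).2
    refine tendsto_of_tendsto_ξ hin ?_
    simp only [hg₀]
    exact ((hk.comp (P.continuous_ξ a)).tendsto p).mono_left nhdsWithin_le_nhds
  obtain ⟨g, hg, -, h⟩ := exists_continuous_lift (isClosedMap_ξ a) (finite_fiber_ξ a)
    (ModelStrip.dense_inner (S := P.S a))
    (fun p N hN => by
      obtain ⟨H, h1, h2, h3, -⟩ := ModelStrip.exists_nhds_subset_isPreconnected hN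
      exact ⟨H, h1, h2, h3⟩)
    (hk.comp (P.continuous_ξ a)) hcont (fun p _ => hg₀ p)
  exact ⟨g, hg, h⟩

theorem IsLift.mem_inner {h : P.homeoGroup} {a : A} {g : (P.S a).Pt ≃ₜ (P.S a).Pt}
    (hg : P.IsLift h.1 a g) (hi : ∀ z ∈ P.inner a, h.1 z ∈ P.inner a) {p : (P.S a).Pt}
    (hp : p ∈ (P.S a).inner) : g p ∈ (P.S a).inner := by
  have := hi _ ⟨p, hp, rfl⟩
  rw [← hg p] at this
  exact (ξ_mem_inner.1 this).2

theorem IsLift.eq {h : P.homeoGroup} {a : A} {g g' : (P.S a).Pt ≃ₜ (P.S a).Pt}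
    (hg : P.IsLift h.1 a g) (hg' : P.IsLift h.1 a g') (hi : ∀ z ∈ P.inner a, h.1 z ∈ P.inner a) :
    g' = g :=
  Homeomorph.ext fun x => congrFun (g'.continuous.ext_on ModelStrip.dense_inner g.continuous
    fun p hp => eq_of_ξ_eq' (hg.mem_inner hi hp) ((hg' p).trans (hg p).symm)) x

theorem exists_isLift (hred : P.IsReduced) {h : P.homeoGroup} {a : A}
    (hs : h.1 '' P.strip a = P.strip a) : ∃ g, P.IsLift h.1 a g := by
  have hinv : ∀ z, h.1 (h.1.symm z) = z := h.1.apply_symm_apply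
  obtain ⟨g, hg, hgξ⟩ := exists_lift_fun (a := a) h.1.continuous
    (fun z hz => (apply_mem_strip hs).2 hz) fun z hz => (apply_mem_inner hred hs).2 hz
  obtain ⟨g', hg', hgξ'⟩ := exists_lift_fun (a := a) h.1.symm.continuous
    (fun z hz => (apply_mem_strip hs).1 (by rwa [hinv]))
    fun z hz => (apply_mem_inner hred hs).1 (by rwa [hinv])
  have h1 : g' ∘ g = id := (hg'.comp hg).ext_on ModelStrip.dense_inner continuous_id fun p hp =>
    eq_of_ξ_eq' hp (by simp [hgξ', hgξ])
  have h2 : g ∘ g' = id := (hg.comp hg').ext_on ModelStrip.dense_inner continuous_id fun p hp =>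
    eq_of_ξ_eq' hp (by simp [hgξ', hgξ])
  exact ⟨⟨⟨g, g', congrFun h1, congrFun h2⟩, hg, hg'⟩, hgξ⟩

theorem IsLift.snd_eq_iff {h : P.homeoGroup} {a : A} {g : (P.S a).Pt ≃ₜ (P.S a).Pt}
    (hg : P.IsLift h.1 a g) (hi : ∀ z ∈ P.inner a, h.1 z ∈ P.inner a) {p q : (P.S a).Pt}
    (hp : p ∈ (P.S a).inner) : (g q).1.2 = (g p).1.2 ↔ q.1.2 = p.1.2 := by
  have key : ∀ {p q : (P.S a).Pt}, p ∈ (P.S a).inner →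
      (q.1.2 = p.1.2 ↔ SameLeaf (P.ξ a p) (P.ξ a q)) := by
    intro p q hp
    rw [sameLeaf_ξ hp]
    constructor
    · exact fun h => ⟨q, h, rfl⟩
    · rintro ⟨r, hr, e⟩
      have hr' : r ∈ (P.S a).inner := by
        show r.1.2 ∈ Ioo (-1 : ℝ) 1
        rw [hr]
        exact hp
      rwa [eq_of_ξ_eq' hr' e.symm]
  rw [key hp, key (hg.mem_inner hi hp), hg p, hg q, sameLeaf_apply]

/-- The lift of a leaf-preserving homeomorphism to a strip has the form `(λ(x, y), μ(y))`. -/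
theorem IsLift.exists_hasForm {h : P.homeoGroup} {a : A} {g : (P.S a).Pt ≃ₜ (P.S a).Pt}
    (hg : P.IsLift h.1 a g) (hi : ∀ z, h.1 z ∈ P.inner a ↔ z ∈ P.inner a) :
    ∃ lam mu, HasForm g lam mu := by
  classical
  have hi' : ∀ z ∈ P.inner a, h.1 z ∈ P.inner a := fun z hz => (hi z).2 hz
  let m : ℝ → ℝ := fun y => if hy : y ∈ Ioo (-1 : ℝ) 1 then (g ⟨(0, y), Or.inl hy⟩).1.2 else 0
  have hm : ∀ p ∈ (P.S a).inner, (g p).1.2 = m p.1.2 := by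
    intro p hp
    have hp' : p.1.2 ∈ Ioo (-1 : ℝ) 1 := hp
    simp only [m, dif_pos hp']
    exact (hg.snd_eq_iff hi' (p := ⟨(0, p.1.2), Or.inl hp⟩) hp).2 rfl
  have hmIoo : ∀ y (hy : y ∈ Ioo (-1 : ℝ) 1), m y = (g ⟨(0, y), Or.inl hy⟩).1.2 := fun y hy =>
    (hm ⟨(0, y), Or.inl hy⟩ hy).symm
  have hcont : ContinuousOn m (Ioo (-1) 1) := by
    rw [continuousOn_iff_continuous_domRestrict]
    have : (Ioo (-1 : ℝ) 1).domRestrict m =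
        fun y : Ioo (-1 : ℝ) 1 => (g ⟨(0, y), Or.inl y.2⟩).1.2 :=
      funext fun y => hmIoo y y.2
    rw [this]
    fun_prop
  have hinj : InjOn m (Ioo (-1) 1) := by
    intro y hy z hz hyz
    rw [hmIoo y hy, hmIoo z hz] at hyz
    exact (hg.snd_eq_iff hi' (p := ⟨(0, z), Or.inl hz⟩) hz).1 hyz
  have himg : m '' Ioo (-1) 1 = Ioo (-1) 1 := by
    apply Subset.antisymm
    · rintro _ ⟨y, hy, rfl⟩
      rw [hmIoo y hy]
      exact hg.mem_inner hi' (p := ⟨(0, y), Or.inl hy⟩) hy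
    · intro y hy
      obtain ⟨p, hp⟩ := g.surjective ⟨(0, y), Or.inl hy⟩
      have hpi : p ∈ (P.S a).inner := by
        have : P.ξ a p ∈ P.inner a := by
          rw [← hi, ← hg p, hp]
          exact ⟨_, hy, rfl⟩
        exact (ξ_mem_inner.1 this).2
      refine ⟨p.1.2, hpi, ?_⟩
      rw [← hm p hpi, hp]
  obtain ⟨mu, hmu⟩ := exists_homeomorph_Icc_of_injOn hcont hinj himg
  refine ⟨⟨fun p => (g p).1.1, by fun_prop⟩, mu, fun p y hy => Prod.ext rfl ?_⟩
  have hext : (fun p => (g p).1.2) =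
      fun p : (P.S a).Pt => (mu ⟨p.1.2, ModelStrip.mem_Icc p⟩ : ℝ) := by
    refine Continuous.ext_on ModelStrip.dense_inner (by fun_prop) (by fun_prop) fun p hp => ?_
    show (g p).1.2 = mu ⟨p.1.2, ModelStrip.mem_Icc p⟩
    rw [hmu ⟨p.1.2, ModelStrip.mem_Icc p⟩ hp, hm p hp]
  obtain ⟨y, hy'⟩ := y
  obtain rfl : p.1.2 = y := hy
  exact congrFun hext p

end StrippedSurface

/-! ### Monotone self-maps of a strip -/

namespace ModelStrip

variable {S : ModelStrip}

/-- A self-map of a model strip that maps each boundary interval to itself, permutes the horizontal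
lines in an order-preserving way, and is increasing on each leaf. -/
structure MonoMap (g : S.Pt → S.Pt) : Prop where
  continuous : Continuous g
  snd_lt : ∀ p q, p.1.2 < q.1.2 → (g p).1.2 < (g q).1.2
  snd_eq : ∀ p q, p.1.2 = q.1.2 → (g p).1.2 = (g q).1.2
  fst_lt : ∀ L, S.IsLeaf L → ∀ p ∈ L, ∀ q ∈ L, p.1.1 < q.1.1 → (g p).1.1 < (g q).1.1
  mapsTo : ∀ I : S.Interval, MapsTo g I.toSet I.toSet
  surjective : Function.Surjective g

theorem exists_snd_lt {p : S.Pt} (hp : p ∈ S.inner) : ∃ q : S.Pt, q.1.2 < p.1.2 := by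
  obtain ⟨y, h1, h2⟩ := exists_between hp.1
  exact ⟨⟨(0, y), Or.inl ⟨h1, h2.trans hp.2⟩⟩, h2⟩

theorem exists_lt_snd {p : S.Pt} (hp : p ∈ S.inner) : ∃ q : S.Pt, p.1.2 < q.1.2 := by
  obtain ⟨y, h1, h2⟩ := exists_between hp.2
  exact ⟨⟨(0, y), Or.inl ⟨hp.1.trans h1, h2⟩⟩, h1⟩

namespace MonoMap

variable {g : S.Pt → S.Pt} (hg : MonoMap g)

include hg

theorem snd_le {p q : S.Pt} (h : p.1.2 ≤ q.1.2) : (g p).1.2 ≤ (g q).1.2 := by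
  rcases h.lt_or_eq with h | h
  · exact (hg.snd_lt _ _ h).le
  · exact (hg.snd_eq _ _ h).le

theorem snd_eq_iff {p q : S.Pt} : (g p).1.2 = (g q).1.2 ↔ p.1.2 = q.1.2 := by
  refine ⟨fun h => ?_, hg.snd_eq p q⟩
  rcases lt_trichotomy p.1.2 q.1.2 with h' | h' | h'
  · exact absurd h (hg.snd_lt _ _ h').ne
  · exact h'
  · exact absurd h (hg.snd_lt _ _ h').ne'

theorem mem_interval_iff {I : S.Interval} {p : S.Pt} : g p ∈ I.toSet ↔ p ∈ I.toSet := by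
  refine ⟨fun h => ?_, fun h => hg.mapsTo I h⟩
  by_cases hp : p ∈ S.inner
  · -- an inner point has points above and below it, and so has its image
    obtain ⟨q, hq⟩ := exists_snd_lt hp
    obtain ⟨r, hr⟩ := exists_lt_snd hp
    have h1 := hg.snd_lt _ _ hq
    have h2 := hg.snd_lt _ _ hr
    exact absurd ⟨(mem_Icc (g q)).1.trans_lt h1, h2.trans_le (mem_Icc (g r)).2⟩
      (I.notMem_inner h)
  · obtain ⟨J, hJ⟩ := exists_interval_of_notMem hp
    rwa [Interval.eq_of_mem h (hg.mapsTo J hJ)]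

theorem mem_inner_iff {p : S.Pt} : g p ∈ S.inner ↔ p ∈ S.inner := by
  constructor
  · intro h
    by_contra hp
    obtain ⟨J, hJ⟩ := exists_interval_of_notMem hp
    exact J.notMem_inner (hg.mapsTo J hJ) h
  · intro h
    by_contra hp
    obtain ⟨J, hJ⟩ := exists_interval_of_notMem hp
    exact J.notMem_inner (hg.mem_interval_iff.1 hJ) h

theorem image_interval (I : S.Interval) : g '' I.toSet = I.toSet := by
  apply Subset.antisymm
  · exact (hg.mapsTo I).image_subset
  · intro p hp
    obtain ⟨q, rfl⟩ := hg.surjective p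
    exact ⟨q, hg.mem_interval_iff.1 hp, rfl⟩

theorem isLeaf_image {L : Set S.Pt} (hL : S.IsLeaf L) : S.IsLeaf (g '' L) := by
  rcases hL with ⟨y, hy, rfl⟩ | ⟨I, rfl⟩
  · set p : S.Pt := ⟨(0, y), Or.inl hy⟩ with hp
    refine Or.inl ⟨(g p).1.2, (hg.mem_inner_iff (p := p)).2 hy, ?_⟩
    ext q
    constructor
    · rintro ⟨r, hr, rfl⟩
      exact hg.snd_eq r p hr
    · intro hq
      obtain ⟨r, rfl⟩ := hg.surjective q
      exact ⟨r, hg.snd_eq_iff.1 hq, rfl⟩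
  · rw [hg.image_interval]
    exact I.isLeaf

theorem injective : Function.Injective g := by
  intro p q h
  obtain ⟨L, hL, hp⟩ := S.exists_isLeaf_mem p
  have h2 : p.1.2 = q.1.2 := hg.snd_eq_iff.1 (by rw [h])
  have hq : q ∈ L := by
    rcases hL with ⟨y, hy, rfl⟩ | ⟨I, rfl⟩
    · exact h2.symm.trans hp
    · exact hg.mem_interval_iff.1 (h ▸ hg.mapsTo I hp)
  rcases hL.eq_or_lt_or_gt hp hq with h3 | h3 | h3
  · exact h3
  · exact absurd (hg.fst_lt L hL p hp q hq h3) (by rw [h]; exact lt_irrefl _)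
  · exact absurd (hg.fst_lt L hL q hq p hp h3) (by rw [h]; exact lt_irrefl _)

/-- A monotone self-map of a strip acts on the heights by an increasing homeomorphism. -/
theorem exists_height : ∃ μ : Icc (-1 : ℝ) 1 ≃ₜ Icc (-1 : ℝ) 1, StrictMono μ ∧
    ∀ p : S.Pt, (g p).1.2 = μ ⟨p.1.2, mem_Icc p⟩ := by
  classical
  let m : ℝ → ℝ := fun y => if hy : y ∈ Ioo (-1 : ℝ) 1 then (g ⟨(0, y), Or.inl hy⟩).1.2 else 0
  have hm : ∀ p ∈ S.inner, (g p).1.2 = m p.1.2 := by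
    intro p hp
    have hp' : p.1.2 ∈ Ioo (-1 : ℝ) 1 := hp
    simp only [m, dif_pos hp']
    exact hg.snd_eq _ _ rfl
  have hmIoo : ∀ y (hy : y ∈ Ioo (-1 : ℝ) 1), m y = (g ⟨(0, y), Or.inl hy⟩).1.2 := fun y hy =>
    (hm ⟨(0, y), Or.inl hy⟩ hy).symm
  obtain ⟨μ, hμ, hμm⟩ := exists_homeomorph_Icc_of_strictMonoOn (m := m)
    (fun y hy z hz hyz => by
      rw [hmIoo y hy, hmIoo z hz]
      exact hg.snd_lt _ _ hyz)
    (by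
      apply Subset.antisymm
      · rintro _ ⟨y, hy, rfl⟩
        rw [hmIoo y hy]
        exact (hg.mem_inner_iff (p := ⟨(0, y), Or.inl hy⟩)).2 hy
      · intro y hy
        obtain ⟨p, hp⟩ := hg.surjective ⟨(0, y), Or.inl hy⟩
        have hpi : p ∈ S.inner := hg.mem_inner_iff.1 (hp ▸ hy)
        exact ⟨p.1.2, hpi, by rw [← hm p hpi, hp]⟩)
  refine ⟨μ, hμ, fun p => ?_⟩
  have hgc := hg.continuous
  have hext : (fun p => (g p).1.2) = fun p : S.Pt => (μ ⟨p.1.2, mem_Icc p⟩ : ℝ) := by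
    refine Continuous.ext_on dense_inner (by fun_prop) (by fun_prop) fun p hp => ?_
    show (g p).1.2 = μ ⟨p.1.2, mem_Icc p⟩
    rw [hμm ⟨p.1.2, mem_Icc p⟩ hp, hm p hp]
  exact congrFun hext p

/-- A monotone self-map of a strip is open: the images of the horizontal segments of a small box
vary continuously with the height, hence cover a neighbourhood. -/
theorem isOpenMap : IsOpenMap g := by
  intro U hU
  rw [isOpen_iff_mem_nhds]
  rintro _ ⟨p, hpU, rfl⟩
  obtain ⟨μ, -, hμ⟩ := hg.exists_height
  obtain ⟨L, hL, hpL⟩ := S.exists_isLeaf_mem p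
  obtain ⟨ε, hε, hbox⟩ := mem_nhds_iff.1
    (Filter.inter_mem (hU.mem_nhds hpU) (hL.eventually_mem hpL))
  have hbox0 : ∀ x, |x - p.1.1| < ε → ∃ h : (x, p.1.2) ∈ S.carrier,
      (⟨(x, p.1.2), h⟩ : S.Pt) ∈ L := by
    intro x hx
    obtain ⟨h, -, h2⟩ := hbox x p.1.2 hx (by simpa using hε) (mem_Icc p)
    exact ⟨h, h2 rfl⟩
  obtain ⟨hl, hlL⟩ := hbox0 (p.1.1 - ε / 2) (by rw [abs_lt]; constructor <;> linarith)
  obtain ⟨hr, hrL⟩ := hbox0 (p.1.1 + ε / 2) (by rw [abs_lt]; constructor <;> linarith)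
  obtain ⟨c, hc1, hc2⟩ := exists_between
    (hg.fst_lt L hL _ hlL p hpL (by show p.1.1 - _ < _; linarith))
  obtain ⟨d, hd1, hd2⟩ := exists_between
    (hg.fst_lt L hL p hpL _ hrL (by show _ < p.1.1 + _; linarith))
  have hgf : Continuous fun q => (g q).1.1 := by
    have := hg.continuous
    fun_prop
  obtain ⟨δ₁, hδ₁, hbox1⟩ := mem_nhds_iff.1 ((isOpen_Iio.preimage hgf).mem_nhds hc1)
  obtain ⟨δ₂, hδ₂, hbox2⟩ := mem_nhds_iff.1 ((isOpen_Ioi.preimage hgf).mem_nhds hd2)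
  have hν : Continuous fun r : S.Pt => (μ.symm ⟨r.1.2, mem_Icc r⟩ : ℝ) := by fun_prop
  have hν0 : (μ.symm ⟨(g p).1.2, mem_Icc (g p)⟩ : ℝ) = p.1.2 := by
    have : (⟨(g p).1.2, mem_Icc (g p)⟩ : Icc (-1 : ℝ) 1) = μ ⟨p.1.2, mem_Icc p⟩ :=
      Subtype.ext (hμ p)
    rw [this, μ.symm_apply_apply]
  have hev : ∀ᶠ r : S.Pt in 𝓝 (g p),
      |(μ.symm ⟨r.1.2, mem_Icc r⟩ : ℝ) - p.1.2| < min ε (min δ₁ δ₂) := by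
    refine (hν.sub continuous_const).abs.continuousAt.eventually_lt continuousAt_const ?_
    show |(μ.symm ⟨(g p).1.2, mem_Icc (g p)⟩ : ℝ) - p.1.2| < _
    rw [hν0, sub_self, abs_zero]
    exact lt_min hε (lt_min hδ₁ hδ₂)
  have hfst : ∀ᶠ r : S.Pt in 𝓝 (g p), r.1.1 ∈ Ioo c d :=
    (isOpen_Ioo.preimage (f := fun r : S.Pt => r.1.1) (by fun_prop)).mem_nhds ⟨hc2, hd1⟩
  filter_upwards [hev, hfst] with r hr1 hr2
  obtain ⟨y, hy⟩ : ∃ y : Icc (-1 : ℝ) 1, y = μ.symm ⟨r.1.2, mem_Icc r⟩ := ⟨_, rfl⟩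
  rw [← hy] at hr1
  have hyε := hr1.trans_le (min_le_left _ _)
  have hyδ₁ := hr1.trans_le ((min_le_right _ _).trans (min_le_left _ _))
  have hyδ₂ := hr1.trans_le ((min_le_right _ _).trans (min_le_right _ _))
  obtain ⟨hl', hl2⟩ := hbox1 (p.1.1 - ε / 2) y (by simpa using hδ₁) hyδ₁ y.2
  obtain ⟨hr', hr3⟩ := hbox2 (p.1.1 + ε / 2) y (by simpa using hδ₂) hyδ₂ y.2
  have hseg : ∀ x ∈ Icc (p.1.1 - ε / 2) (p.1.1 + ε / 2), ∃ h : (x, (y : ℝ)) ∈ S.carrier,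
      (⟨(x, (y : ℝ)), h⟩ : S.Pt) ∈ U := by
    intro x hx
    obtain ⟨h, h2, -⟩ := hbox x y (by rw [abs_lt]; constructor <;> linarith [hx.1, hx.2]) hyε y.2
    exact ⟨h, h2⟩
  have hconn := isPreconnected_horizontal (S := S)
    (convex_Icc (p.1.1 - ε / 2) (p.1.1 + ε / 2)) (y := y) fun x hx => (hseg x hx).1
  obtain ⟨q, ⟨hq1, hq2⟩, hq3⟩ := hconn.intermediate_value
    (a := ⟨(p.1.1 - ε / 2, y), hl'⟩) (b := ⟨(p.1.1 + ε / 2, y), hr'⟩)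
    ⟨⟨le_rfl, by linarith⟩, rfl⟩ ⟨⟨by linarith, le_rfl⟩, rfl⟩ hgf.continuousOn
    ⟨hl2.le.trans hr2.1.le, hr2.2.le.trans hr3.le⟩
  have hqe : q = ⟨(q.1.1, (y : ℝ)), (hseg _ hq1).1⟩ := Subtype.ext (Prod.ext rfl hq2)
  refine ⟨q, hqe ▸ (hseg _ hq1).2, Subtype.ext (Prod.ext hq3 ?_)⟩
  have : (⟨q.1.2, mem_Icc q⟩ : Icc (-1 : ℝ) 1) = μ.symm ⟨r.1.2, mem_Icc r⟩ :=
    (Subtype.ext hq2).trans hy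
  rw [hμ, this, μ.apply_symm_apply]

end MonoMap

theorem monoMap_id : MonoMap (id : S.Pt → S.Pt) where
  continuous := continuous_id
  snd_lt := fun _ _ h => h
  snd_eq := fun _ _ h => h
  fst_lt := fun _ _ _ _ _ _ h => h
  mapsTo := fun _ _ h => h
  surjective := Function.surjective_id

/-- The point with the first coordinate on the way from `p` to `q` at the fraction `s` and the
second one at the fraction `t`. -/
def mix (s t : ℝ) (p q : ℝ × ℝ) : ℝ × ℝ := ((1 - s) * p.1 + s * q.1, (1 - t) * p.2 + t * q.2)

theorem mul_add_mul_mem_Ioo {l r x x' s : ℝ} (hx : x ∈ Ioo l r) (hx' : x' ∈ Ioo l r)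
    (hs : s ∈ Icc (0 : ℝ) 1) : (1 - s) * x + s * x' ∈ Ioo l r := by
  have := convex_Ioo l r hx hx' (sub_nonneg.2 hs.2) hs.1 (by ring)
  simpa using this

theorem mul_add_mul_lt {x x' y y' s : ℝ} (h : x < y) (h' : x' < y') (hs : s ∈ Icc (0 : ℝ) 1) :
    (1 - s) * x + s * x' < (1 - s) * y + s * y' := by
  rcases hs.1.eq_or_lt with rfl | h0
  · simpa using h
  · have := mul_lt_mul_of_pos_left h' h0
    have := mul_le_mul_of_nonneg_left h.le (sub_nonneg.2 hs.2)
    linarith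

namespace MonoMap

variable {g : S.Pt → S.Pt}

theorem mix_mem (hg : MonoMap g) {s t : ℝ} (hs : s ∈ Icc (0 : ℝ) 1) (ht : t ∈ Icc (0 : ℝ) 1)
    (p : S.Pt) : mix s t p.1 (g p).1 ∈ S.carrier := by
  by_cases hp : p ∈ S.inner
  · exact Or.inl (mul_add_mul_mem_Ioo hp (hg.mem_inner_iff.2 hp) ht)
  · obtain ⟨I, hI⟩ := exists_interval_of_notMem hp
    have hI' := hg.mapsTo I hI
    refine Or.inr ⟨I.side, ?_, _, I.mem, mul_add_mul_mem_Ioo hI.2 hI'.2 hs⟩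
    show (1 - t) * p.1.2 + t * (g p).1.2 = _
    rw [hI.1, hI'.1]
    ring

/-- The straight-line deformation of the identity map to a monotone self-map `g` of a strip, with
independent parameters `s` and `t` for the two coordinates. -/
def interp (hg : MonoMap g) (s t : Icc (0 : ℝ) 1) (p : S.Pt) : S.Pt :=
  ⟨mix s t p.1 (g p).1, hg.mix_mem s.2 t.2 p⟩

theorem interp_fst (hg : MonoMap g) (s t : Icc (0 : ℝ) 1) (p : S.Pt) :
    (hg.interp s t p).1.1 = (1 - (s : ℝ)) * p.1.1 + s * (g p).1.1 := rfl

theorem interp_snd (hg : MonoMap g) (s t : Icc (0 : ℝ) 1) (p : S.Pt) :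
    (hg.interp s t p).1.2 = (1 - (t : ℝ)) * p.1.2 + t * (g p).1.2 := rfl

theorem continuous_interp (hg : MonoMap g) (s t : Icc (0 : ℝ) 1) :
    Continuous (hg.interp s t) := by
  have := hg.continuous
  unfold interp mix
  fun_prop

theorem interp_snd_lt (hg : MonoMap g) (s t : Icc (0 : ℝ) 1) {p q : S.Pt} (h : p.1.2 < q.1.2) :
    (hg.interp s t p).1.2 < (hg.interp s t q).1.2 :=
  mul_add_mul_lt h (hg.snd_lt _ _ h) t.2

theorem interp_mapsTo (hg : MonoMap g) (s t : Icc (0 : ℝ) 1) (I : S.Interval) :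
    MapsTo (hg.interp s t) I.toSet I.toSet := by
  intro p hp
  have hp' := hg.mapsTo I hp
  refine ⟨?_, mul_add_mul_mem_Ioo hp.2 hp'.2 s.2⟩
  rw [interp_snd, hp.1, hp'.1]
  ring

/-- If `g` takes the first coordinate of `p₁` somewhere on the leaf of `p₁`, then so does each
interpolation, by the intermediate value theorem. -/
theorem exists_interp_fst_eq (hg : MonoMap g) (s t : Icc (0 : ℝ) 1) {L : Set S.Pt}
    (hL : S.IsLeaf L) {p₁ q : S.Pt} (hp : p₁ ∈ L) (hq : q ∈ L) (h : (g q).1.1 = p₁.1.1) :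
    ∃ p ∈ L, (hg.interp s t p).1.1 = p₁.1.1 := by
  have hc : ContinuousOn (fun p => (hg.interp s t p).1.1) L :=
    (continuous_fst.comp (continuous_subtype_val.comp (hg.continuous_interp s t))).continuousOn
  have h0 := s.2.1
  have h1 := s.2.2
  rcases le_total p₁.1.1 q.1.1 with hle | hle
  · have hle' : (g p₁).1.1 ≤ (g q).1.1 := by
      rcases hL.eq_or_lt_or_gt hp hq with h2 | h2 | h2
      · rw [h2]
      · exact (hg.fst_lt L hL _ hp _ hq h2).le
      · exact absurd hle h2.not_ge
    obtain ⟨p, hpL, he⟩ := hL.isPreconnected.intermediate_value hp hq hc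
      (show p₁.1.1 ∈ Icc _ _ from ⟨by rw [interp_fst]; nlinarith, by rw [interp_fst]; nlinarith⟩)
    exact ⟨p, hpL, he⟩
  · have hle' : (g q).1.1 ≤ (g p₁).1.1 := by
      rcases hL.eq_or_lt_or_gt hp hq with h2 | h2 | h2
      · rw [h2]
      · exact absurd hle h2.not_ge
      · exact (hg.fst_lt L hL _ hq _ hp h2).le
    obtain ⟨p, hpL, he⟩ := hL.isPreconnected.intermediate_value hq hp hc
      (show p₁.1.1 ∈ Icc _ _ from ⟨by rw [interp_fst]; nlinarith, by rw [interp_fst]; nlinarith⟩)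
    exact ⟨p, hpL, he⟩

theorem interp_snd_eq (hg : MonoMap g) (s t : Icc (0 : ℝ) 1) {p q : S.Pt} (h : p.1.2 = q.1.2) :
    (hg.interp s t p).1.2 = (hg.interp s t q).1.2 := by
  rw [interp_snd, interp_snd, h, hg.snd_eq p q h]

theorem interp_surjective (hg : MonoMap g) (s t : Icc (0 : ℝ) 1) :
    Function.Surjective (hg.interp s t) := by
  intro r
  have h0 := t.2.1
  have h1 := t.2.2
  -- the inner heights first, then the position on the leaf
  by_cases hr : r ∈ S.inner
  · obtain ⟨q, hq⟩ := hg.surjective r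
    have hqi : q ∈ S.inner := hg.mem_inner_iff.1 (hq ▸ hr)
    have hconn : IsPreconnected S.inner := isPreconnected_levels le_rfl le_rfl
    have hc : ContinuousOn (fun p => (hg.interp s t p).1.2) S.inner :=
      (continuous_snd.comp (continuous_subtype_val.comp (hg.continuous_interp s t))).continuousOn
    obtain ⟨p₀, hp₀, hp₀r⟩ : ∃ p₀ ∈ S.inner, (hg.interp s t p₀).1.2 = r.1.2 := by
      rcases le_total r.1.2 q.1.2 with hle | hle
      · have hle' := hg.snd_le hle
        rw [hq] at hle'
        obtain ⟨p, hpL, he⟩ := hconn.intermediate_value hr hqi hc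
          (show r.1.2 ∈ Icc _ _ from ⟨by rw [interp_snd]; nlinarith,
            by rw [interp_snd, hq]; nlinarith⟩)
        exact ⟨p, hpL, he⟩
      · have hle' := hg.snd_le hle
        rw [hq] at hle'
        obtain ⟨p, hpL, he⟩ := hconn.intermediate_value hqi hr hc
          (show r.1.2 ∈ Icc _ _ from ⟨by rw [interp_snd, hq]; nlinarith,
            by rw [interp_snd]; nlinarith⟩)
        exact ⟨p, hpL, he⟩
    set p₁ : S.Pt := ⟨(r.1.1, p₀.1.2), Or.inl hp₀⟩ with hp₁
    obtain ⟨q', hq'⟩ := hg.surjective ⟨(r.1.1, (g p₀).1.2), Or.inl (hg.mem_inner_iff.2 hp₀)⟩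
    have hq'2 : q'.1.2 = p₀.1.2 := hg.snd_eq_iff.1 (by rw [hq'])
    obtain ⟨p, hp, he⟩ := hg.exists_interp_fst_eq s t (isLeaf_line hp₀) (p₁ := p₁) (q := q') rfl
      hq'2 (by rw [hq'])
    exact ⟨p, Subtype.ext (Prod.ext he ((hg.interp_snd_eq s t hp).trans hp₀r))⟩
  · obtain ⟨I, hI⟩ := exists_interval_of_notMem hr
    obtain ⟨q, hq⟩ := hg.surjective r
    obtain ⟨p, hp, he⟩ := hg.exists_interp_fst_eq s t I.isLeaf (p₁ := r) (q := q) hI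
      (hg.mem_interval_iff.1 (hq ▸ hI)) (by rw [hq])
    exact ⟨p, Subtype.ext (Prod.ext he ((hg.interp_mapsTo s t I hp).1.trans hI.1.symm))⟩

/-- The straight-line deformation runs through monotone maps. -/
theorem monoMap_interp (hg : MonoMap g) (s t : Icc (0 : ℝ) 1) : MonoMap (hg.interp s t) where
  continuous := hg.continuous_interp s t
  snd_lt := fun _ _ h => hg.interp_snd_lt s t h
  snd_eq := fun _ _ h => hg.interp_snd_eq s t h
  fst_lt := fun L hL p hp q hq h => mul_add_mul_lt h (hg.fst_lt L hL p hp q hq h) s.2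
  mapsTo := hg.interp_mapsTo s t
  surjective := hg.interp_surjective s t

theorem interp_one_one (hg : MonoMap g) : hg.interp 1 1 = g :=
  funext fun p => Subtype.ext (Prod.ext (by simp [interp_fst]) (by simp [interp_snd]))

theorem interp_zero_zero (hg : MonoMap g) : hg.interp 0 0 = id :=
  funext fun p => Subtype.ext (Prod.ext (by simp [interp_fst]) (by simp [interp_snd]))

end MonoMap

theorem locallyCompactSpace_pt (S : ModelStrip) : LocallyCompactSpace S.Pt := by
  refine IsLocallyClosed.locallyCompactSpace ?_
  refine ((isLocallyClosed_tfae S.carrier).out 0 3).2 fun z hz => ?_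
  obtain ⟨ε, hε, hbox⟩ := exists_box_subset (⟨z, hz⟩ : S.Pt)
  refine ⟨Metric.ball z ε, Metric.mem_ball_self hε, Metric.isOpen_ball, ?_⟩
  rintro w ⟨hw, hwc⟩
  rw [Metric.mem_ball, Prod.dist_eq] at hw
  have hcl : IsClosed {w : ℝ × ℝ | w.2 ∈ Icc (-1 : ℝ) 1} := isClosed_Icc.preimage continuous_snd
  exact hbox w.1 w.2 ((le_max_left _ _).trans_lt hw) ((le_max_right _ _).trans_lt hw)
    (closure_minimal (fun v hv => mem_Icc (⟨v, hv⟩ : S.Pt)) hcl hwc)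

end ModelStrip

/-! ### Homeomorphisms with monotone lifts -/

namespace StrippedSurface

open ModelStrip

variable {A : Type u} {B : Type v} {P : StrippedSurface A B}

/-- The self-map of the disjoint union of the strips given by self-maps of the strips. -/
def totalMap (g : ∀ a, (P.S a).Pt → (P.S a).Pt) (x : P.Total) : P.Total := ⟨x.1, g x.1 x.2⟩

theorem totalMap_mem_pts {g : ∀ a, (P.S a).Pt → (P.S a).Pt} (hg : ∀ a, MonoMap (g a))
    {I : Σ a, (P.S a).Interval} {x : P.Total} : totalMap g x ∈ P.pts I ↔ x ∈ P.pts I := by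
  obtain ⟨a, p⟩ := x
  constructor
  · intro h
    obtain ⟨J, rfl, hJ⟩ := mem_pts_mk h
    exact mk_mem_pts ((hg a).mem_interval_iff.1 hJ)
  · intro h
    obtain ⟨J, rfl, hJ⟩ := mem_pts_mk h
    exact mk_mem_pts ((hg a).mapsTo J hJ)

theorem glue_of_mem_pts {b : B} {x y : P.Total} (hx : x ∈ P.pts (P.Y b)) (hy : y ∈ P.pts (P.X b))
    (h : y.2.1.1 = P.φ b x.2.1.1) : P.Glue x y := by
  obtain ⟨p, hp, rfl⟩ := hx
  obtain ⟨q, hq, rfl⟩ := hy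
  have hp' : (P.Y b).2.point ⟨p.1.1, hp.2⟩ = p := Subtype.ext (Prod.ext rfl hp.1.symm)
  have hq' : (P.X b).2.point ⟨q.1.1, hq.2⟩ = q := Subtype.ext (Prod.ext rfl hq.1.symm)
  have := Glue.mk b ⟨p.1.1, hp.2⟩ ⟨q.1.1, hq.2⟩ h
  rwa [hp', hq'] at this

/-- The maps `g a` are monotone lifts of the homeomorphism `h` to the strips. -/
def MonoLift (h : P.homeoGroup) (g : ∀ a, (P.S a).Pt → (P.S a).Pt) : Prop :=
  (∀ a, MonoMap (g a)) ∧ ∀ a p, P.ξ a (g a p) = h.1 (P.ξ a p)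

theorem homeoGroup_ext {h h' : P.homeoGroup} (e : ∀ a p, h.1 (P.ξ a p) = h'.1 (P.ξ a p)) :
    h = h' := by
  refine Subtype.ext (Homeomorph.ext fun z => ?_)
  obtain ⟨a, p, rfl⟩ := P.exists_ξ_eq z
  exact e a p

/-- Monotone maps of the strips that respect the identifications define a leaf-preserving
homeomorphism of the surface. -/
theorem exists_monoLift {g : ∀ a, (P.S a).Pt → (P.S a).Pt} (hg : ∀ a, MonoMap (g a))
    (hglue : ∀ x y, P.Glue x y → P.Glue (totalMap g x) (totalMap g y)) :
    ∃ h : P.homeoGroup, MonoLift h g := by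
  let k : P.Z → P.Z := Quot.map (totalMap g) hglue
  have hk : ∀ x, k (P.proj x) = P.proj (totalMap g x) := fun _ => rfl
  have hGinj : Function.Injective (totalMap g) := by
    rintro ⟨a, p⟩ ⟨b, q⟩ h
    obtain rfl : a = b := congrArg Sigma.fst h
    exact congrArg (Sigma.mk a) ((hg a).injective (eq_of_heq (Sigma.mk.inj h).2))
  have hGc : Continuous (totalMap g) := by
    rw [continuous_sigma_iff]
    exact fun a => continuous_sigmaMk.comp (hg a).continuous
  have hGclosed : IsClosedMap (totalMap g) := by
    have hopen : IsOpenMap (totalMap g) := by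
      rw [isOpenMap_sigma]
      exact fun a => isOpenMap_sigmaMk.comp (hg a).isOpenMap
    have hsurj : Function.Surjective (totalMap g) := by
      rintro ⟨a, p⟩
      obtain ⟨q, rfl⟩ := (hg a).surjective p
      exact ⟨⟨a, q⟩, rfl⟩
    exact ((Equiv.ofBijective _ ⟨hGinj, hsurj⟩).toHomeomorphOfContinuousOpen hGc hopen).isClosedMap
  have hkc : Continuous k :=
    P.isQuotientMap_proj.continuous_iff.2 (P.continuous_proj.comp hGc)
  have hkclosed : IsClosedMap k := by
    intro C hC
    have : k '' C = P.proj '' (totalMap g '' (P.proj ⁻¹' C)) := by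
      rw [image_image]
      conv_lhs => rw [← image_preimage_eq C P.proj_surjective, image_image]
      rfl
    rw [this]
    exact isClosedMap_proj _ (hGclosed _ (hC.preimage P.continuous_proj))
  have hksurj : Function.Surjective k := by
    intro z
    obtain ⟨a, p, rfl⟩ := P.exists_ξ_eq z
    obtain ⟨q, rfl⟩ := (hg a).surjective p
    exact ⟨P.ξ a q, rfl⟩
  have hglue' : ∀ x y, P.Glue (totalMap g x) (totalMap g y) → P.proj x = P.proj y := by
    intro x y h
    obtain ⟨b, hx, hy, -⟩ := h.spec
    rw [totalMap_mem_pts hg] at hx hy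
    have hx' := hx
    have hx1 : P.φ b x.2.1.1 ∈ Ioo (P.X b).2.left (P.X b).2.right := by
      obtain ⟨p, hp, rfl⟩ := hx'
      exact P.φ_image b ▸ mem_image_of_mem _ hp.2
    -- the partner of `x` has the same image as `y`
    have hxy' : P.Glue x ⟨(P.X b).1, (P.X b).2.point ⟨_, hx1⟩⟩ :=
      glue_of_mem_pts hx (mk_mem_pts ⟨rfl, hx1⟩) rfl
    have h1 := hglue _ _ hxy'
    obtain ⟨b₁, hb₁, hb₁', e₁⟩ := h.spec
    obtain ⟨b₂, hb₂, hb₂', e₂⟩ := h1.spec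
    obtain rfl := Y_injective (P.eq_of_mem_pts hb₁ hb₂)
    have := hGinj (P.eq_of_mem_pts_of_eq hb₁' hb₂' (e₁.trans e₂.symm))
    rw [this]
    exact Quot.sound hxy'
  have hkinj : Function.Injective k := by
    intro z w h
    obtain ⟨x, rfl⟩ := P.proj_surjective z
    obtain ⟨y, rfl⟩ := P.proj_surjective w
    rw [hk, hk] at h
    rcases P.mk_eq_mk h with h | h | h
    · rw [hGinj h]
    · exact hglue' x y h
    · exact (hglue' y x h).symm
  let H : P.Z ≃ₜ P.Z :=
    (Equiv.ofBijective k ⟨hkinj, hksurj⟩).toHomeomorphOfContinuousClosed hkc hkclosed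
  refine ⟨⟨H, ?_⟩, hg, fun a p => rfl⟩
  rintro _ ⟨a, L, hL, rfl⟩
  refine ⟨a, _, (hg a).isLeaf_image hL, ?_⟩
  rw [image_image, image_image]
  rfl

section MonoLift

variable {h : P.homeoGroup} {g : ∀ a, (P.S a).Pt → (P.S a).Pt} (hg : MonoLift h g)

include hg

theorem MonoLift.apply_mem_inner {a : A} {z : P.Z} (hz : z ∈ P.inner a) : h.1 z ∈ P.inner a := by
  obtain ⟨p, hp, rfl⟩ := hz
  rw [← hg.2]
  exact ⟨_, (hg.1 a).mem_inner_iff.2 hp, rfl⟩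

theorem MonoLift.eq {a : A} {g' : (P.S a).Pt → (P.S a).Pt} (hc : Continuous g')
    (hg' : ∀ p, P.ξ a (g' p) = h.1 (P.ξ a p)) : g' = g a :=
  hc.ext_on dense_inner (hg.1 a).continuous fun p hp =>
    eq_of_ξ_eq' ((hg.1 a).mem_inner_iff.2 hp) ((hg' p).trans (hg.2 a p).symm)

/-- Lifts are compatible with the identifications. -/
theorem MonoLift.glue {x y : P.Total} (hxy : P.Glue x y) :
    P.Glue (totalMap g x) (totalMap g y) := by
  have e : P.proj (totalMap g x) = P.proj (totalMap g y) := by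
    have : ∀ x, P.proj (totalMap g x) = h.1 (P.proj x) := fun x => hg.2 x.1 x.2
    rw [this, this]
    exact congrArg h.1 (Quot.sound hxy)
  obtain ⟨b, hx, hy, -⟩ := hxy.spec
  rw [← totalMap_mem_pts hg.1] at hx hy
  rcases P.mk_eq_mk e with e | e | e
  · rw [e] at hx
    exact absurd (P.eq_of_mem_pts hy hx) (P.X_ne_Y b b)
  · exact e
  · obtain ⟨b', hy', -, -⟩ := e.spec
    exact absurd (P.eq_of_mem_pts hy hy') (P.X_ne_Y b b')

theorem MonoLift.image_strip (a : A) : h.1 '' P.strip a = P.strip a := by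
  apply Subset.antisymm
  · rintro _ ⟨_, ⟨p, rfl⟩, rfl⟩
    exact ⟨g a p, hg.2 a p⟩
  · rintro _ ⟨p, rfl⟩
    obtain ⟨q, rfl⟩ := (hg.1 a).surjective p
    exact ⟨P.ξ a q, ⟨q, rfl⟩, (hg.2 a q).symm⟩

/-- The lift to a strip is a homeomorphism of the form `(λ(x, y), μ(y))`, increasing in both
variables. -/
theorem MonoLift.exists_isLift (a : A) : ∃ g' lam mu, P.IsLift h.1 a g' ∧ HasForm g' lam mu ∧
    StrictMono mu ∧ IncreasingOnLines lam := by
  have hga := hg.1 a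
  obtain ⟨μ, hμ, hform⟩ := hga.exists_height
  refine ⟨(Equiv.ofBijective _ ⟨hga.injective, hga.surjective⟩).toHomeomorphOfContinuousOpen
    hga.continuous hga.isOpenMap, ⟨fun p => (g a p).1.1, ?_⟩, μ, hg.2 a, ?_, hμ, ?_⟩
  · have := hga.continuous
    fun_prop
  · rintro p ⟨y, hy'⟩ hy
    obtain rfl : p.1.2 = y := hy
    exact Prod.ext rfl (hform p)
  · exact fun p q e hp hlt => hga.fst_lt _ (isLeaf_line hp) p rfl q e.symm hlt

theorem MonoLift.preservesOrientedLeaf {ω : Set P.Z} (hω : P.IsLeaf ω)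
    (hmaps : ∀ a L, (P.S a).IsLeaf L → P.ξ a '' L = ω → MapsTo (g a) L L) :
    P.PreservesOrientedLeaf h.1 ω := by
  have hω' := hω
  obtain ⟨a, L, hL, rfl⟩ := hω'
  refine ⟨?_, fun b L' hL' e p hp q hq p' hp' q' hq' h1 h2 => ?_⟩
  · obtain ⟨p, hp⟩ : L.Nonempty := by
      rcases hL with ⟨y, hy, rfl⟩ | ⟨I, rfl⟩
      · exact ⟨⟨(0, y), Or.inl hy⟩, rfl⟩
      · exact I.nonempty
    exact (h.2 _ hω).eq_of_mem hω (mem_image_of_mem _ (mem_image_of_mem _ hp))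
      (by rw [← hg.2]; exact mem_image_of_mem _ (hmaps a L hL rfl hp))
  · have key : ∀ r ∈ L', ∀ r' ∈ L', h.1 (P.ξ b r) = P.ξ b r' → r' = g b r :=
      fun r hr r' hr' e' => P.ξ_injOn_leaf hL' hr' (hmaps b L' hL' e hr) (by rw [hg.2, e'])
    rw [key p hp p' hp' h1, key q hq q' hq' h2]
    rcases hL'.eq_or_lt_or_gt hp hq with h3 | h3 | h3
    · rw [h3]
      exact iff_of_false (lt_irrefl _) (lt_irrefl _)
    · exact iff_of_true h3 ((hg.1 b).fst_lt _ hL' p hp q hq h3)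
    · exact iff_of_false h3.not_gt ((hg.1 b).fst_lt _ hL' q hq p hp h3).not_gt

theorem MonoLift.preservesOrientedLeaf_bdLeaf (I : Σ a, (P.S a).Interval) :
    P.PreservesOrientedLeaf h.1 (P.bdLeaf I) := by
  refine hg.preservesOrientedLeaf (isLeaf_bdLeaf I) fun a L hL e => ?_
  rcases hL with ⟨y, hy, rfl⟩ | ⟨J, rfl⟩
  · have hm : P.ξ a ⟨(0, y), Or.inl hy⟩ ∈ P.bdLeaf I := by
      rw [← e]
      exact ⟨_, rfl, rfl⟩
    exact absurd hm (notMem_bdLeaf ⟨_, hy, rfl⟩ I)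
  · exact (hg.1 a).mapsTo J

theorem MonoLift.mem_homeoGroup₀' (hid : ∀ a p, (g a p).1.2 = p.1.2) :
    h ∈ P.homeoGroup₀' := by
  intro ω hω
  refine hg.preservesOrientedLeaf hω fun a L hL _ => ?_
  rcases hL with ⟨y, hy, rfl⟩ | ⟨J, rfl⟩
  · exact fun p hp => (hid a p).trans hp
  · exact (hg.1 a).mapsTo J

theorem MonoLift.interp_glue (s t : Icc (0 : ℝ) 1) {x y : P.Total} (hxy : P.Glue x y) :
    P.Glue (totalMap (fun a => (hg.1 a).interp s t) x)
      (totalMap (fun a => (hg.1 a).interp s t) y) := by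
  obtain ⟨b, hx, hy, e⟩ := hxy.spec
  obtain ⟨b', hx', -, e'⟩ := (hg.glue hxy).spec
  obtain rfl := Y_injective (P.eq_of_mem_pts hx ((totalMap_mem_pts hg.1).1 hx'))
  have hm := fun a => (hg.1 a).monoMap_interp s t
  refine glue_of_mem_pts ((totalMap_mem_pts hm).2 hx) ((totalMap_mem_pts hm).2 hy) ?_
  have h1 := (P.φ b).apply_lineMap x.2.1.1 (totalMap g x).2.1.1 (s : ℝ)
  rw [← e, ← e', AffineMap.lineMap_apply_module, AffineMap.lineMap_apply_module] at h1
  exact h1.symm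

end MonoLift

end StrippedSurface

/-! ### The characterization of the identity component -/

/-- A homeomorphism of `[-1, 1]` that keeps the order of one pair of points is increasing. -/
theorem strictMono_of_homeomorph {μ : Icc (-1 : ℝ) 1 ≃ₜ Icc (-1 : ℝ) 1} {y z : Icc (-1 : ℝ) 1}
    (hyz : y < z) (h : μ y < μ z) : StrictMono μ := by
  have hle : (-1 : ℝ) ≤ 1 := by norm_num
  have hproj : ∀ y : Icc (-1 : ℝ) 1, projIcc (-1 : ℝ) 1 hle y = y := projIcc_val hle
  have hc : ContinuousOn (fun y : ℝ => (μ (projIcc (-1) 1 hle y) : ℝ)) (Icc (-1) 1) :=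
    (continuous_subtype_val.comp (μ.continuous.comp continuous_projIcc)).continuousOn
  have hinj : InjOn (fun y : ℝ => (μ (projIcc (-1) 1 hle y) : ℝ)) (Icc (-1) 1) := by
    intro y hy z hz e
    have e' := μ.injective (Subtype.ext e)
    rw [projIcc_of_mem hle hy, projIcc_of_mem hle hz] at e'
    exact congrArg Subtype.val e'
  rcases hc.strictMonoOn_of_injOn_Icc' hle hinj with hm | hm
  · intro y z hyz
    have := hm y.2 z.2 hyz
    simp only [hproj] at this
    exact this
  · have := hm y.2 z.2 hyz
    simp only [hproj] at this
    exact absurd h (not_lt_of_gt this)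

namespace StrippedSurface

open ModelStrip

variable {A : Type u} {B : Type v} {P : StrippedSurface A B}

/-- A continuous self-map of a strip that is increasing on the lines is weakly increasing on the
two sides. -/
theorem fst_le_of_inner {S : ModelStrip} {g : S.Pt → S.Pt} (hg : Continuous g)
    (hfst : ∀ p ∈ S.inner, ∀ q ∈ S.inner, p.1.2 = q.1.2 → p.1.1 < q.1.1 → (g p).1.1 < (g q).1.1)
    {p q : S.Pt} (h2 : p.1.2 = q.1.2) (h1 : p.1.1 < q.1.1) : (g p).1.1 ≤ (g q).1.1 := by
  have hgf : Continuous fun q => (g q).1.1 := by fun_prop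
  refine le_of_tendsto_of_tendsto ((hgf.tendsto p).comp (tendsto_push p))
    ((hgf.tendsto q).comp (tendsto_push q)) ?_
  refine Filter.eventually_of_mem self_mem_nhdsWithin fun t ht => ?_
  refine (hfst _ (push_mem_inner p ht) _ (push_mem_inner q ht) ?_ h1).le
  show (1 - (t : ℝ)) * p.1.2 = (1 - t) * q.1.2
  rw [h2]

/-- The lift of a homeomorphism that preserves the leaves in the boundary of the strips and is
increasing in both variables maps each boundary interval to itself: it cannot exchange two intervals
of one side that are glued to one another, as it is monotone on that side. -/
theorem IsLift.mapsTo_interval {h : P.homeoGroup} {a : A} {g : (P.S a).Pt ≃ₜ (P.S a).Pt}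
    (hg : P.IsLift h.1 a g) (hb : ∀ I, h.1 '' P.bdLeaf I = P.bdLeaf I)
    (hside : ∀ s, ∀ p : (P.S a).Pt, p.1.2 = stripLevel s → (g p).1.2 = stripLevel s)
    (hfst : ∀ p ∈ (P.S a).inner, ∀ q ∈ (P.S a).inner, p.1.2 = q.1.2 → p.1.1 < q.1.1 →
      (g p).1.1 < (g q).1.1) (I : (P.S a).Interval) : MapsTo g I.toSet I.toSet := by
  -- images of points of an interval lie on it or on the interval glued to it
  have hmem : ∀ (J : (P.S a).Interval), ∀ r ∈ J.toSet, g r ∈ J.toSet ∨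
      ∃ K : (P.S a).Interval, Glued (P := P) ⟨a, J⟩ ⟨a, K⟩ ∧ g r ∈ K.toSet := by
    intro J r hr
    have : P.proj ⟨a, g r⟩ ∈ P.bdLeaf ⟨a, J⟩ := by
      rw [proj_mk, hg r, ← hb]
      exact mem_image_of_mem _ ⟨r, hr, rfl⟩
    rcases mem_bdLeaf this with h1 | ⟨K, hK, h1⟩
    · obtain ⟨J', e, h2⟩ := mem_pts_mk h1
      rw [eq_of_heq (Sigma.mk.inj e).2]
      exact Or.inl h2
    · obtain ⟨K', rfl, h2⟩ := mem_pts_mk h1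
      exact Or.inr ⟨K', hK, h2⟩
  intro p hp
  refine (hmem I p hp).resolve_right ?_
  rintro ⟨J, hIJ, hJ⟩
  have hpJ : P.ξ a p ∈ P.bdLeaf ⟨a, J⟩ := hIJ.bdLeaf_eq ▸ ⟨p, hp, rfl⟩
  -- `q` is the point identified with `p`
  obtain ⟨q, hq, hqp⟩ := hpJ
  have hne : p ≠ q := by
    rintro rfl
    exact hIJ.ne (congrArg (Sigma.mk a) (Interval.eq_of_mem hp hq))
  have hgq : g q ∈ I.toSet := by
    rcases hmem J q hq with h1 | ⟨K, hK, h1⟩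
    · have : P.ξ a (g p) = P.ξ a (g q) := by
        rw [hg p, hg q]
        exact congrArg h.1 hqp.symm
      exact absurd (g.injective (P.ξ_injOn_leaf J.isLeaf hJ h1 this)) hne
    · rwa [← eq_of_heq (Sigma.mk.inj (hIJ.symm.unique hK)).2] at h1
  have hs : I.side = J.side :=
    stripLevel_injective ((hside _ p hp.1).symm.trans hJ.1)
  have hIJ' : I ≠ J := fun e => hIJ.ne (congrArg (Sigma.mk a) e)
  have hlevel : p.1.2 = q.1.2 := by rw [hp.1, hq.1, hs]
  -- the two intervals are disjoint, hence one lies on the left of the other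
  rcases lt_or_ge I.right J.left with hlt | hge
  · have h1 := fst_le_of_inner g.continuous hfst hlevel (by linarith [hp.2.2, hq.2.1])
    linarith [hJ.2.1, hgq.2.2]
  · have hge' : J.right < I.left := by
      by_contra! hcon
      have hIlt := (P.S a).lt_of_mem _ _ I.mem
      have hJlt := (P.S a).lt_of_mem _ _ J.mem
      dsimp only at hIlt hJlt
      exact hIJ' (Interval.eq_of_mem_Icc hs (x := max I.left J.left)
        ⟨le_max_left _ _, max_le hIlt.le hge⟩ ⟨le_max_right _ _, max_le hcon hJlt.le⟩)
    have h1 := fst_le_of_inner g.continuous hfst hlevel.symm (by linarith [hp.2.1, hq.2.2])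
    linarith [hJ.2.2, hgq.2.1]

/-- A homeomorphism that preserves the strips and the leaves in their boundaries and whose lifts
are increasing over the open strips has monotone lifts. -/
theorem exists_monoLift_of_inner {h : P.homeoGroup} (hi : ∀ a z, h.1 z ∈ P.inner a ↔ z ∈ P.inner a)
    (hb : ∀ I, h.1 '' P.bdLeaf I = P.bdLeaf I)
    (hl : ∀ a, ∃ g, P.IsLift h.1 a g ∧
      (∀ p ∈ (P.S a).inner, ∀ q ∈ (P.S a).inner, p.1.2 < q.1.2 → (g p).1.2 < (g q).1.2) ∧
      ∀ p ∈ (P.S a).inner, ∀ q ∈ (P.S a).inner, p.1.2 = q.1.2 → p.1.1 < q.1.1 →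
        (g p).1.1 < (g q).1.1) : ∃ g, MonoLift h g := by
  choose g hg hsnd hfst using hl
  refine ⟨fun a => g a, fun a => ?_, fun a p => hg a p⟩
  obtain ⟨lam, mu, hform⟩ := (hg a).exists_hasForm (hi a)
  have hform' : ∀ p, (g a p).1.2 = mu ⟨p.1.2, mem_Icc p⟩ := fun p =>
    congrArg Prod.snd (hform p ⟨p.1.2, mem_Icc p⟩ rfl)
  have hmu : StrictMono mu := by
    have h0 : (0 : ℝ) ∈ Ioo (-1 : ℝ) 1 := by norm_num
    have h1 : (1 / 2 : ℝ) ∈ Ioo (-1 : ℝ) 1 := by norm_num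
    have := hsnd a ⟨(0, 0), Or.inl h0⟩ h0 ⟨(0, 1 / 2), Or.inl h1⟩ h1 (by norm_num)
    rw [hform', hform'] at this
    exact strictMono_of_homeomorph (y := ⟨0, Ioo_subset_Icc_self h0⟩)
      (z := ⟨1 / 2, Ioo_subset_Icc_self h1⟩) (by rw [Subtype.mk_lt_mk]; norm_num) this
  have hlt : ∀ p q, p.1.2 < q.1.2 → (g a p).1.2 < (g a q).1.2 := by
    intro p q h
    rw [hform', hform']
    exact hmu (show (⟨p.1.2, mem_Icc p⟩ : Icc (-1 : ℝ) 1) < ⟨q.1.2, mem_Icc q⟩ from h)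
  have heq : ∀ p q, p.1.2 = q.1.2 → (g a p).1.2 = (g a q).1.2 := by
    intro p q h
    rw [hform', hform']
    simp only [h]
  have hside : ∀ s, ∀ p : (P.S a).Pt, p.1.2 = stripLevel s → (g a p).1.2 = stripLevel s := by
    intro s p hp
    have hp' : g a p ∉ (P.S a).inner := by
      intro h
      have : P.ξ a p ∈ P.inner a := by
        rw [← hi, ← hg a p]
        exact ⟨_, h, rfl⟩
      have h2 : p.1.2 ∈ Ioo (-1 : ℝ) 1 := (ξ_mem_inner.1 this).2
      rw [hp] at h2
      exact stripLevel_not_mem s h2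
    obtain ⟨s', hs'⟩ := eq_stripLevel_of_mem_Icc (mem_Icc (g a p)) hp'
    have hz : (0 : ℝ) ∈ Ioo (-1 : ℝ) 1 := by norm_num
    have hz1 := mem_Icc (g a ⟨(0, 0), Or.inl hz⟩)
    rw [hs']
    cases s
    · have := hlt p ⟨(0, 0), Or.inl hz⟩ (by rw [hp]; simp [stripLevel])
      cases s'
      · rfl
      · rw [hs'] at this
        simp only [stripLevel, if_true] at this
        exact absurd this hz1.2.not_gt
    · have := hlt ⟨(0, 0), Or.inl hz⟩ p (by rw [hp]; simp [stripLevel])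
      cases s'
      · rw [hs'] at this
        simp only [stripLevel, Bool.false_eq_true, if_false] at this
        exact absurd this hz1.1.not_gt
      · rfl
  have hmaps := (hg a).mapsTo_interval hb hside (hfst a)
  refine ⟨(g a).continuous, hlt, heq, ?_, hmaps, (g a).surjective⟩
  rintro _ (⟨y, hy, rfl⟩ | ⟨I, rfl⟩) p hp q hq hpq
  · have hp' : p.1.2 = y := hp
    have hq' : q.1.2 = y := hq
    exact hfst a p (by show p.1.2 ∈ Ioo (-1 : ℝ) 1; rwa [hp']) q
      (by show q.1.2 ∈ Ioo (-1 : ℝ) 1; rwa [hq']) (hp'.trans hq'.symm) hpq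
  · have h2 : p.1.2 = q.1.2 := hp.1.trans hq.1.symm
    refine lt_of_le_of_ne (fst_le_of_inner (g a).continuous (hfst a) h2 hpq) fun e => ?_
    have : p = q := (g a).injective (Subtype.ext (Prod.ext e (heq p q h2)))
    rw [this] at hpq
    exact lt_irrefl _ hpq

theorem exists_monoLift_of_conditions (hred : P.IsReduced) {h : P.homeoGroup}
    (ha : ∀ a, h.1 '' P.strip a = P.strip a)
    (hb : ∀ a, ∃ g lam mu, P.IsLift h.1 a g ∧ HasForm g lam mu ∧
      StrictMono mu ∧ IncreasingOnLines lam)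
    (hc : ∀ ω, P.IsBoundaryLeaf ω ∨ P.IsSpecialLeaf ω → P.PreservesOrientedLeaf h.1 ω) :
    ∃ g, MonoLift h g := by
  refine exists_monoLift_of_inner (fun a z => apply_mem_inner hred (ha a)) (fun I => ?_) fun a => ?_
  · refine (hc _ ?_).1
    by_cases hX : I ∈ range P.X
    · obtain ⟨b, rfl⟩ := hX
      exact Or.inr (hred b)
    · by_cases hY : I ∈ range P.Y
      · obtain ⟨b, rfl⟩ := hY
        rw [P.bdLeaf_eq]
        exact Or.inr (hred b)
      · exact Or.inl ⟨I, hX, hY, rfl⟩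
  · obtain ⟨g, lam, mu, hg, hform, hmu, hlam⟩ := hb a
    have h1 : ∀ p, (g p).1 = (lam p, (mu ⟨p.1.2, mem_Icc p⟩ : ℝ)) := fun p => hform p _ rfl
    refine ⟨g, hg, fun p _ q _ hpq => ?_, fun p hp q _ h2 hpq => ?_⟩
    · rw [h1, h1]
      exact hmu (show (⟨p.1.2, mem_Icc p⟩ : Icc (-1 : ℝ) 1) < ⟨q.1.2, mem_Icc q⟩ from hpq)
    · rw [h1, h1]
      exact hlam p q h2 hp hpq

/-- Homeomorphisms that preserve each leaf with its orientation have monotone lifts, which keep the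
heights. -/
theorem exists_monoLift_of_mem_homeoGroup₀' (hred : P.IsReduced) {h : P.homeoGroup}
    (hh : h ∈ P.homeoGroup₀') : ∃ g, MonoLift h g ∧ ∀ a p, (g a p).1.2 = p.1.2 := by
  have ha : ∀ a, h.1 '' P.strip a = P.strip a := by
    have hleaf : ∀ a (p : (P.S a).Pt), ∃ L, p ∈ L ∧ h.1 '' (P.ξ a '' L) = P.ξ a '' L := by
      intro a p
      obtain ⟨L, hL, hp⟩ := (P.S a).exists_isLeaf_mem p
      exact ⟨L, hp, (hh _ ⟨a, L, hL, rfl⟩).1⟩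
    intro a
    apply Subset.antisymm
    · rintro _ ⟨_, ⟨p, rfl⟩, rfl⟩
      obtain ⟨L, hp, e⟩ := hleaf a p
      obtain ⟨q, -, hq⟩ : h.1 (P.ξ a p) ∈ P.ξ a '' L :=
        e ▸ mem_image_of_mem _ (mem_image_of_mem _ hp)
      exact ⟨q, hq⟩
    · rintro _ ⟨p, rfl⟩
      obtain ⟨L, hp, e⟩ := hleaf a p
      obtain ⟨_, ⟨q, -, rfl⟩, hq⟩ : P.ξ a p ∈ h.1 '' (P.ξ a '' L) := e.symm ▸ mem_image_of_mem _ hp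
      exact ⟨_, ⟨q, rfl⟩, hq⟩
  have hlines : ∀ a (g : (P.S a).Pt ≃ₜ (P.S a).Pt), P.IsLift h.1 a g → ∀ p ∈ (P.S a).inner,
      (g p).1.2 = p.1.2 := by
    intro a g hg p hp
    have hm : h.1 (P.ξ a p) ∈ P.ξ a '' {q : (P.S a).Pt | q.1.2 = p.1.2} := by
      rw [← (hh _ ⟨a, _, isLeaf_line hp, rfl⟩).1]
      exact mem_image_of_mem _ (mem_image_of_mem _ rfl)
    obtain ⟨q, hq, e⟩ := hm
    have hqi : q ∈ (P.S a).inner := by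
      show q.1.2 ∈ Ioo (-1 : ℝ) 1
      rw [show q.1.2 = p.1.2 from hq]
      exact hp
    rw [eq_of_ξ_eq' hqi ((hg p).trans e.symm)]
    exact hq
  obtain ⟨g, hg⟩ := exists_monoLift_of_inner (fun a z => apply_mem_inner hred (ha a))
    (fun I => (hh _ (isLeaf_bdLeaf I)).1) fun a => by
      obtain ⟨g, hg⟩ := exists_isLift hred (ha a)
      refine ⟨g, hg, fun p hp q hq hpq => ?_, fun p hp q hq h2 hpq => ?_⟩
      · rwa [hlines a g hg p hp, hlines a g hg q hq]
      · have hgp := hlines a g hg p hp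
        have hgq := hlines a g hg q hq
        exact ((hh _ ⟨a, _, isLeaf_line hp, rfl⟩).2 a _ (isLeaf_line hp) rfl p rfl q h2.symm (g p)
          hgp (g q) (hgq.trans h2.symm) (hg p).symm (hg q).symm).1 hpq
  refine ⟨g, hg, fun a p => ?_⟩
  obtain ⟨g', lam, mu, hg', -⟩ := hg.exists_isLift a
  have e : ⇑g' = g a := hg.eq g'.continuous hg'
  have hc := (hg.1 a).continuous
  have : (fun p => (g a p).1.2) = fun p : (P.S a).Pt => p.1.2 := by
    refine Continuous.ext_on dense_inner (by fun_prop) (by fun_prop) fun p hp => ?_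
    show (g a p).1.2 = p.1.2
    rw [← e]
    exact hlines a g' hg' p hp
  exact congrFun this p

end StrippedSurface

/-! ### Paths of leaf-preserving homeomorphisms -/

namespace StrippedSurface

open ModelStrip

variable {A : Type u} {B : Type v} {P : StrippedSurface A B}

theorem continuous_toContinuousMap :
    Continuous fun h : P.homeoGroup => (⟨h.1, h.1.continuous⟩ : C(P.Z, P.Z)) :=
  continuous_induced_dom

theorem continuous_apply_point (z : P.Z) : Continuous fun h : P.homeoGroup => h.1 z :=
  (continuous_eval_const (F := C(P.Z, P.Z)) z).comp continuous_toContinuousMap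

theorem isClosed_bdLeaf (I : Σ a, (P.S a).Interval) : IsClosed (P.bdLeaf I) :=
  isClosedMap_ξ I.1 _ I.2.isClosed

/-- The leaves in the boundaries of the strips are open in the complement of the open strips. -/
theorem isOpen_inner_union_bdLeaf (I : Σ a, (P.S a).Interval) :
    IsOpen ((⋃ a, P.inner a) ∪ P.bdLeaf I) := by
  rw [← P.isQuotientMap_proj.isOpen_preimage, isOpen_sigma_iff]
  intro a
  rw [isOpen_iff_mem_nhds]
  rintro p (hp | hp)
  · refine Filter.mem_of_superset (((isOpen_iUnion fun a => isOpen_inner (P := P) a).preimage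
      (P.continuous_ξ a)).mem_nhds hp) fun q hq => Or.inl hq
  · have hp' : p ∉ (P.S a).inner := fun h => notMem_bdLeaf ⟨p, h, rfl⟩ I hp
    obtain ⟨J, hJ⟩ := exists_interval_of_notMem hp'
    have e : P.bdLeaf ⟨a, J⟩ = P.bdLeaf I :=
      (isLeaf_bdLeaf _).eq_of_mem (isLeaf_bdLeaf I) (z := P.ξ a p) ⟨p, hJ, rfl⟩ hp
    filter_upwards [Interval.inner_union_mem_nhds hJ] with q hq
    rcases hq with hq | hq
    · exact Or.inl (mem_iUnion.2 ⟨a, q, hq, rfl⟩)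
    · exact Or.inr (e ▸ ⟨q, hq, rfl⟩)

theorem disjoint_inner {a b : A} {z : P.Z} (ha : z ∈ P.inner a) (hb : z ∈ P.inner b) : a = b := by
  obtain ⟨p, hp, rfl⟩ := ha
  exact (ξ_mem_inner.1 hb).1

theorem path_mem_inner (hred : P.IsReduced) {γ : unitInterval → P.homeoGroup} (hγ : Continuous γ)
    (h0 : γ 0 = 1) {a : A} {z : P.Z} (hz : z ∈ P.inner a) (t : unitInterval) :
    (γ t).1 z ∈ P.inner a := by
  have hc : Continuous fun t => (γ t).1 z := (continuous_apply_point z).comp hγ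
  have hclopen : IsClopen {t | (γ t).1 z ∈ P.inner a} := by
    refine ⟨?_, (isOpen_inner a).preimage hc⟩
    rw [← isOpen_compl_iff]
    convert (isOpen_iUnion fun b : {b // b ≠ a} => isOpen_inner (P := P) b.1).preimage hc using 1
    ext t
    simp only [mem_compl_iff, mem_preimage, mem_iUnion]
    constructor
    · intro ht
      obtain ⟨b, hb⟩ := (exists_mem_inner_apply hred (γ t)).2 ⟨a, hz⟩
      exact ⟨⟨b, fun e => ht (e ▸ hb)⟩, hb⟩
    · rintro ⟨b, hb⟩ ht
      exact b.2 (disjoint_inner hb ht)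
  have := hclopen.eq_univ ⟨0, by show (γ 0).1 z ∈ P.inner a; rw [h0]; exact hz⟩
  exact eq_univ_iff_forall.1 this t

theorem path_mem_bdLeaf (hred : P.IsReduced) {γ : unitInterval → P.homeoGroup} (hγ : Continuous γ)
    (h0 : γ 0 = 1) {I : Σ a, (P.S a).Interval} {z : P.Z} (hz : z ∈ P.bdLeaf I) (t : unitInterval) :
    (γ t).1 z ∈ P.bdLeaf I := by
  have hc : Continuous fun t => (γ t).1 z := (continuous_apply_point z).comp hγ
  have hni : ∀ t, (γ t).1 z ∉ ⋃ a, P.inner a := by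
    intro t ht
    obtain ⟨a, ha⟩ := (exists_mem_inner_apply hred (γ t)).1 (mem_iUnion.1 ht)
    exact notMem_bdLeaf ha I hz
  have hclopen : IsClopen {t | (γ t).1 z ∈ P.bdLeaf I} := by
    refine ⟨(isClosed_bdLeaf I).preimage hc, ?_⟩
    convert (isOpen_inner_union_bdLeaf I).preimage hc using 1
    ext t
    exact ⟨fun h => Or.inr h, fun h => h.resolve_left (hni t)⟩
  have := hclopen.eq_univ ⟨0, by show (γ 0).1 z ∈ P.bdLeaf I; rw [h0]; exact hz⟩
  exact eq_univ_iff_forall.1 this t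

theorem image_bdLeaf_of_apply_mem {h : P.homeoGroup}
    (H : ∀ I, ∀ z ∈ P.bdLeaf I, h.1 z ∈ P.bdLeaf I) (I : Σ a, (P.S a).Interval) :
    h.1 '' P.bdLeaf I = P.bdLeaf I := by
  obtain ⟨p, hp⟩ := I.2.nonempty
  have hz : P.ξ I.1 p ∈ P.bdLeaf I := ⟨p, hp, rfl⟩
  exact (h.2 _ (isLeaf_bdLeaf I)).eq_of_mem (isLeaf_bdLeaf I) (mem_image_of_mem _ hz) (H I _ hz)

theorem image_strip_of_apply_mem (hred : P.IsReduced) {h : P.homeoGroup}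
    (hi : ∀ a, ∀ z ∈ P.inner a, h.1 z ∈ P.inner a)
    (H : ∀ I, ∀ z ∈ P.bdLeaf I, h.1 z ∈ P.bdLeaf I) (a : A) : h.1 '' P.strip a = P.strip a := by
  have hsub : ∀ I : (P.S a).Interval, P.bdLeaf ⟨a, I⟩ ⊆ P.strip a := fun I => image_subset_range _ _
  apply Subset.antisymm
  · rintro _ ⟨_, ⟨p, rfl⟩, rfl⟩
    by_cases hp : p ∈ (P.S a).inner
    · obtain ⟨q, -, hq⟩ := hi a _ ⟨p, hp, rfl⟩
      exact ⟨q, hq⟩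
    · obtain ⟨I, hI⟩ := exists_interval_of_notMem hp
      exact hsub I (H ⟨a, I⟩ _ ⟨p, hI, rfl⟩)
  · rintro _ ⟨p, rfl⟩
    by_cases hp : p ∈ (P.S a).inner
    · obtain ⟨z, hz⟩ := h.1.surjective (P.ξ a p)
      have hpi : h.1 z ∈ P.inner a := hz ▸ ⟨p, hp, rfl⟩
      obtain ⟨b, hb⟩ := (exists_mem_inner_apply hred h).1 ⟨a, hpi⟩
      obtain rfl := disjoint_inner (hi b z hb) hpi
      obtain ⟨q, -, hq⟩ := hb
      exact ⟨z, ⟨q, hq⟩, hz⟩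
    · obtain ⟨I, hI⟩ := exists_interval_of_notMem hp
      have : P.ξ a p ∈ h.1 '' P.bdLeaf ⟨a, I⟩ := by
        rw [image_bdLeaf_of_apply_mem H]
        exact ⟨p, hI, rfl⟩
      exact image_mono (hsub I) this

theorem pos_of_ne_zero {f : unitInterval → ℝ} (hf : Continuous f) (hne : ∀ t, f t ≠ 0)
    (h0 : 0 < f 0) (t : unitInterval) : 0 < f t := by
  by_contra! h
  obtain ⟨s, hs⟩ := mem_range_of_exists_le_of_exists_ge hf ⟨t, h⟩ ⟨0, h0.le⟩
  exact hne s hs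

/-- Along a path that starts at the identity, the lifts remain increasing in both variables. -/
theorem exists_monoLift_of_path (hred : P.IsReduced) {γ : unitInterval → P.homeoGroup}
    (hγ : Continuous γ) (h0 : γ 0 = 1) : ∃ g, MonoLift (γ 1) g := by
  have hin : ∀ t a, ∀ z ∈ P.inner a, (γ t).1 z ∈ P.inner a := fun t a z hz =>
    path_mem_inner hred hγ h0 hz t
  have hbd : ∀ t I, ∀ z ∈ P.bdLeaf I, (γ t).1 z ∈ P.bdLeaf I := fun t I z hz =>
    path_mem_bdLeaf hred hγ h0 hz t
  have hstrip : ∀ t a, (γ t).1 '' P.strip a = P.strip a := fun t =>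
    image_strip_of_apply_mem hred (hin t) (hbd t)
  have hlift : ∀ a t, ∃ g, P.IsLift (γ t).1 a g := fun a t => exists_isLift hred (hstrip t a)
  choose g hg using hlift
  have hgin : ∀ a t, ∀ p ∈ (P.S a).inner, g a t p ∈ (P.S a).inner := fun a t p hp =>
    (hg a t).mem_inner (hin t a) hp
  have hg0 : ∀ a, ∀ p ∈ (P.S a).inner, g a 0 p = p := fun a p hp => by
    refine eq_of_ξ_eq' hp ?_
    rw [hg a 0 p, h0]
    rfl
  have hcont : ∀ a, ∀ p ∈ (P.S a).inner, Continuous fun t => g a t p := by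
    intro a p hp
    rw [continuous_iff_continuousAt]
    intro t
    refine tendsto_of_tendsto_ξ (hgin a t p hp) ?_
    simp only [hg a _ p]
    exact ((continuous_apply_point _).comp hγ).tendsto t
  refine exists_monoLift_of_inner (fun a z => apply_mem_inner hred (hstrip 1 a))
    (image_bdLeaf_of_apply_mem (hbd 1)) fun a => ⟨g a 1, hg a 1, ?_, ?_⟩
  · intro p hp q hq hpq
    have hpc := hcont a p hp
    have hqc := hcont a q hq
    refine sub_pos.1 (pos_of_ne_zero (f := fun t => (g a t q).1.2 - (g a t p).1.2) (by fun_prop)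
      (fun t ht => ?_) ?_ 1)
    · exact hpq.ne' (((hg a t).snd_eq_iff (hin t a) hp).1 (sub_eq_zero.1 ht))
    · show 0 < (g a 0 q).1.2 - (g a 0 p).1.2
      rw [hg0 a p hp, hg0 a q hq]
      exact sub_pos.2 hpq
  · intro p hp q hq h2 hpq
    have hpc := hcont a p hp
    have hqc := hcont a q hq
    refine sub_pos.1 (pos_of_ne_zero (f := fun t => (g a t q).1.1 - (g a t p).1.1) (by fun_prop)
      (fun t ht => ?_) ?_ 1)
    · have h3 := ((hg a t).snd_eq_iff (hin t a) hp).2 h2.symm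
      have := (g a t).injective (Subtype.ext (Prod.ext (sub_eq_zero.1 ht) h3))
      rw [this] at hpq
      exact lt_irrefl _ hpq
    · show 0 < (g a 0 q).1.1 - (g a 0 p).1.1
      rw [hg0 a p hp, hg0 a q hq]
      exact sub_pos.2 hpq

/-! ### The straight-line deformation -/

/-- The leaf-preserving homeomorphisms with monotone lifts to all strips. -/
def monoSet (P : StrippedSurface A B) : Set P.homeoGroup := {h | ∃ g, MonoLift h g}

/-- The monotone lifts of an element of `monoSet`. -/
noncomputable def lift (h : P.monoSet) (a : A) : (P.S a).Pt → (P.S a).Pt := h.2.choose a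

theorem monoLift_lift (h : P.monoSet) : MonoLift h.1 (lift h) := h.2.choose_spec

theorem lift_eq (h : P.monoSet) {g : ∀ a, (P.S a).Pt → (P.S a).Pt} (hg : MonoLift h.1 g) :
    lift h = g :=
  funext fun a => hg.eq ((monoLift_lift h).1 a).continuous ((monoLift_lift h).2 a)

/-- The lifts depend continuously on the homeomorphism. -/
theorem continuous_lift (a : A) : Continuous fun i : P.monoSet × (P.S a).Pt => lift i.1 a i.2 := by
  have := locallyCompactSpace_pt (P.S a)
  refine continuous_uncurry_of_lift (f := fun (h : P.monoSet) => lift h a) (isClosedMap_ξ a)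
    (finite_fiber_ξ a)
    (fun p N hN => by
      obtain ⟨H, h1, h2, -, h3⟩ := exists_nhds_subset_isPreconnected hN
      exact ⟨H, h1, h2, h3⟩) ?_ (fun h => ((monoLift_lift h).1 a).continuous) fun p => ?_
  · simp only [(monoLift_lift _).2]
    let ξC : C((P.S a).Pt, P.Z) := ⟨P.ξ a, P.continuous_ξ a⟩
    have h1 : Continuous fun h : P.monoSet =>
        (⟨h.1.1, h.1.1.continuous⟩ : C(P.Z, P.Z)).comp ξC :=
      (ContinuousMap.continuous_precomp ξC).comp
        (continuous_toContinuousMap.comp continuous_subtype_val)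
    exact (ContinuousEval.continuous_eval (F := C((P.S a).Pt, P.Z))).comp (h1.prodMap continuous_id)
  · by_cases hp : p ∈ (P.S a).inner
    · exact ⟨univ, isClosed_univ, fun h => ⟨mem_univ _, fun q _ hq =>
        eq_of_ξ_eq' (((monoLift_lift h).1 a).mem_inner_iff.2 hp) hq⟩⟩
    · obtain ⟨I, hI⟩ := exists_interval_of_notMem hp
      refine ⟨I.toSet, I.isClosed, fun h => ?_⟩
      have hm := ((monoLift_lift h).1 a).mapsTo I hI
      exact ⟨hm, fun q hq e => P.ξ_injOn_leaf I.isLeaf hq hm e⟩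

theorem exists_deform (h : P.monoSet) (s t : unitInterval) : ∃ k : P.homeoGroup,
    MonoLift k fun a => ((monoLift_lift h).1 a).interp s t :=
  exists_monoLift (fun a => ((monoLift_lift h).1 a).monoMap_interp s t)
    fun _ _ => (monoLift_lift h).interp_glue s t

/-- The homeomorphism whose lifts are the interpolations, with parameters `s` and `t` for the two
coordinates, between the identity and the lifts of `h`. It is well defined as the identifications
of the boundary intervals are affine. -/
noncomputable def deform (h : P.monoSet) (s t : unitInterval) : P.monoSet :=
  ⟨(exists_deform h s t).choose, _, (exists_deform h s t).choose_spec⟩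

theorem monoLift_deform (h : P.monoSet) (s t : unitInterval) :
    MonoLift (deform h s t).1 fun a => ((monoLift_lift h).1 a).interp s t :=
  (exists_deform h s t).choose_spec

theorem deform_eq_of_interp_eq {h : P.monoSet} {s t : unitInterval} {k : P.homeoGroup}
    (hk : ∀ a p, P.ξ a (((monoLift_lift h).1 a).interp s t p) = k.1 (P.ξ a p)) :
    (deform h s t).1 = k :=
  homeoGroup_ext fun a p => ((monoLift_deform h s t).2 a p).symm.trans (hk a p)

theorem deform_one_one (h : P.monoSet) : deform h 1 1 = h :=
  Subtype.ext (deform_eq_of_interp_eq fun a p => by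
    rw [((monoLift_lift h).1 a).interp_one_one]
    exact (monoLift_lift h).2 a p)

theorem deform_zero_zero (h : P.monoSet) : (deform h 0 0).1 = 1 :=
  deform_eq_of_interp_eq fun a p => by
    rw [((monoLift_lift h).1 a).interp_zero_zero]
    rfl

theorem deform_one_zero_mem (h : P.monoSet) : (deform h 1 0).1 ∈ P.homeoGroup₀' :=
  (monoLift_deform h 1 0).mem_homeoGroup₀' fun a p => by simp [MonoMap.interp_snd]

theorem deform_one_eq (hred : P.IsReduced) {h : P.monoSet} (hh : h.1 ∈ P.homeoGroup₀')
    (t : unitInterval) : deform h 1 t = h := by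
  obtain ⟨g, hg, hsnd⟩ := exists_monoLift_of_mem_homeoGroup₀' hred hh
  refine Subtype.ext (deform_eq_of_interp_eq fun a p => ?_)
  have hl := lift_eq h hg
  have : ((monoLift_lift h).1 a).interp 1 t p = lift h a p := by
    refine Subtype.ext (Prod.ext (by simp [MonoMap.interp_fst]) ?_)
    rw [MonoMap.interp_snd, hl, hsnd]
    ring
  rw [this]
  exact (monoLift_lift h).2 a p

/-- The deformation is jointly continuous: it is so on the strips, and the product of the quotient
map with an identity map is a quotient map, as the quotient map is proper. -/
theorem continuous_deform :
    Continuous fun i : P.monoSet × unitInterval × unitInterval => deform i.1 i.2.1 i.2.2 := by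
  rw [continuous_induced_rng, continuous_induced_rng]
  refine ContinuousMap.continuous_of_continuous_uncurry _ ?_
  have hq : IsQuotientMap (Prod.map (id : P.monoSet × unitInterval × unitInterval → _) P.proj) :=
    have hp := isProperMap_id.prodMap (isProperMap_proj (P := P))
    hp.isClosedMap.isQuotientMap hp.continuous (Function.surjective_id.prodMap P.proj_surjective)
  rw [hq.continuous_iff]
  let e := (Homeomorph.prodComm (P.monoSet × unitInterval × unitInterval) P.Total).trans
    Homeomorph.sigmaProdDistrib
  rw [← e.symm.comp_continuous_iff', continuous_sigma_iff]
  intro a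
  have h1 : Continuous fun i : (P.S a).Pt × P.monoSet × unitInterval × unitInterval =>
      ((monoLift_lift i.2.1).1 a).interp i.2.2.1 i.2.2.2 i.1 := by
    have hl : Continuous fun i : (P.S a).Pt × P.monoSet × unitInterval × unitInterval =>
        lift i.2.1 a i.1 :=
      (continuous_lift a).comp (continuous_snd.fst.prodMk continuous_fst)
    unfold MonoMap.interp mix
    fun_prop
  refine ((P.continuous_ξ a).comp h1).congr fun i => ?_
  exact (monoLift_deform i.2.1 i.2.2.1 i.2.2.2).2 a i.1

theorem homeoGroup₀_eq (hred : P.IsReduced) : P.homeoGroup₀ = P.monoSet := by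
  ext h
  constructor
  · rintro ⟨γ⟩
    have := exists_monoLift_of_path hred γ.continuous γ.source
    rwa [γ.target] at this
  · intro hh
    let k : P.monoSet := ⟨h, hh⟩
    refine ⟨⟨⟨fun t => (deform k t t).1, ?_⟩, ?_, ?_⟩⟩
    · exact continuous_subtype_val.comp (continuous_deform.comp
        (continuous_const.prodMk (continuous_id.prodMk continuous_id)))
    · exact deform_zero_zero k
    · exact congrArg Subtype.val (deform_one_one k)

end StrippedSurface

theorem mainTheorem1 {A : Type u} {B : Type v} (P : StrippedSurface A B)
    (hconn : ConnectedSpace P.Z) (hred : P.IsReduced) :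
    (∀ h : P.homeoGroup, (∀ a, h.1 '' P.strip a = P.strip a) →
      ∀ a, ∃ g, P.IsLift h.1 a g ∧ (∀ g', P.IsLift h.1 a g' → g' = g) ∧
        ∃ lam mu, StrippedSurface.HasForm g lam mu) ∧
    (∀ h : P.homeoGroup, h ∈ P.homeoGroup₀ ↔
      (∀ a, h.1 '' P.strip a = P.strip a) ∧
      (∀ a, ∃ g lam mu, P.IsLift h.1 a g ∧ StrippedSurface.HasForm g lam mu ∧
        StrictMono mu ∧ StrippedSurface.IncreasingOnLines lam) ∧
      (∀ ω, P.IsBoundaryLeaf ω ∨ P.IsSpecialLeaf ω → P.PreservesOrientedLeaf h.1 ω)) ∧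
    IsStrongDeformationRetract (P.homeoGroup₀' : Set P.homeoGroup) P.homeoGroup₀ ∧
    ContractibleSpace P.homeoGroup₀ := by
  rw [StrippedSurface.homeoGroup₀_eq hred]
  refine ⟨fun h hs a => ?_, fun h => ⟨?_, ?_⟩, ⟨?_, ?_⟩, ?_⟩
  · have hi : ∀ z, h.1 z ∈ P.inner a ↔ z ∈ P.inner a := fun z =>
      StrippedSurface.apply_mem_inner hred (hs a)
    obtain ⟨g, hg⟩ := StrippedSurface.exists_isLift hred (hs a)
    exact ⟨g, hg, fun g' hg' => hg.eq hg' fun z hz => (hi z).2 hz, hg.exists_hasForm hi⟩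
  · rintro ⟨g, hg⟩
    refine ⟨hg.image_strip, hg.exists_isLift, ?_⟩
    rintro ω (⟨I, -, -, rfl⟩ | ⟨b, -, rfl⟩) <;> exact hg.preservesOrientedLeaf_bdLeaf _
  · rintro ⟨ha, hb, hc⟩
    exact StrippedSurface.exists_monoLift_of_conditions hred ha hb hc
  · intro h hh
    obtain ⟨g, hg, -⟩ := StrippedSurface.exists_monoLift_of_mem_homeoGroup₀' hred hh
    exact ⟨g, hg⟩
  · refine ⟨⟨fun h => StrippedSurface.deform h 1 0, ?_⟩,
      fun h => StrippedSurface.deform_one_zero_mem h, ⟨⟨⟨⟨fun i =>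
        StrippedSurface.deform i.2 1 (unitInterval.symm i.1), ?_⟩, fun h => ?_, fun h => ?_⟩, ?_⟩⟩⟩
    · exact StrippedSurface.continuous_deform.comp
        (continuous_id.prodMk (continuous_const.prodMk continuous_const))
    · exact StrippedSurface.continuous_deform.comp (continuous_snd.prodMk
        (continuous_const.prodMk (unitInterval.continuous_symm.comp continuous_fst)))
    · simpa using StrippedSurface.deform_one_one h
    · simp
    · exact fun t h hh => StrippedSurface.deform_one_eq hred hh _
  · rw [contractible_iff_id_nullhomotopic]
    refine ⟨StrippedSurface.deform ⟨1, _, fun a => ModelStrip.monoMap_id, fun a p => rfl⟩ 0 0,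
      ⟨⟨⟨fun i => StrippedSurface.deform i.2 (unitInterval.symm i.1) (unitInterval.symm i.1), ?_⟩,
        fun h => ?_, fun h => ?_⟩⟩⟩
    · have hs := unitInterval.continuous_symm.comp
        (continuous_fst (X := unitInterval) (Y := P.monoSet))
      exact StrippedSurface.continuous_deform.comp (continuous_snd.prodMk (hs.prodMk hs))
    · simpa using StrippedSurface.deform_one_one h
    · refine Subtype.ext ?_
      simp [StrippedSurface.deform_zero_zero]
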